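/- **Theorem.** Let $p=3$ and $\xi_3=e^{2\pi i/3}$. For $f:\mathbb F_3^{n}\to\mathbb F_3$ let $\widehat{\chi_f}(\alpha)=\sum_x\xi_3^{f(x)-\alpha\cdot x}$; $f$ is $s$-plateaued ($0\le s\le n$) if $|\widehat{\chi_f}(\alpha)|\in\{0,3^{(n+s)/2}\}$ for all $\alpha$, bent if it is $0$-plateaued, and weakly regular if $\widehat{\chi_f}(\alpha)=\epsilon\,3^{(n+s)/2}\xi_3^{f^*(\alpha)}$ whenever $\widehat{\chi_f}(\alpha)\neq 0$, with $\epsilon\in\{\pm1,\pm i\}$ independent of $\alpha$ and $f^*(\alpha)\in\mathbb F_3$. Consider the functions $$f:\mathbb F_3^{n_1}\times\mathbb F_3^{n_2}\times\mathbb F_3^{n_2}\times\mathbb F_3^{s}\to\mathbb F_3,\qquad f(x,y,z,u)=f^{(z)}(x)+\sum_{i=1}^{n_2}y_iz_i,\qquad n=n_1+2n_2+s,\ n_1,n_2\ge1,\qquad(\ast)$$ where every $f^{(z)}$ is a weakly regular bent function with $f^{(z)}(0)=0$, $f^{(z)}(ax)=a^2f^{(z)}(x)$ and $f^{(az)}=f^{(z)}$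 for all $a\in\mathbb F_3^*$. For $n+s$ even, the type $\epsilon_0\in\{1,-1\}$ of $f$ is defined by $\widehat{\chi_f}(0)=\epsilon_0\,3^{(n+s)/2}\xi_3^{j}$, $j\in\mathbb F_3$. Let $\widetilde D=\{x_1,\dots,x_L\}$ be a set of representatives, up to sign, of the nonzero zeros of $f$, and let $\widetilde{\mathcal C}=\{(a\cdot x_1,\dots,a\cdot x_L):a\in\mathbb F_3^n\}$. (1) For all integers $n,s$ with $n+s$ even, $0\le s\le n-4$, $n+s\ge6$, and for each $\epsilon_0\in\{1,-1\}$, there is an $s$-plateaued function $f$ of the form $(\ast)$ and of type $\epsilon_0$, with $L=\frac{3^{n-1}+2\epsilon_0 3^{(n+s)/2-1}-1}{2}$, which yields a pure $[[L,\,L-2n+2,\,3]]_3$ quantum code. (2) For all integers $n,s$ with $n+s$ odd, $0\le s\le n-3$, $n+s\ge5$, there is an $s$-plateaued function $f$ of the form $(\ast)$, with $L=\frac{3^{n-1}-1}{2}$, which yields a pure $[[L,\,L-2n+2,\,3]]_3$ quantum code. In both cases $\widetilde{\mathcal C}\subseteq\widetilde{\mathcal C}^{\perp}$, and for some subcode $\mathcal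 C\subseteq\widetilde{\mathcal C}$ the quantum code arises from $\widetilde{\mathcal C}\subseteq\widetilde{\mathcal C}^{\perp}\subseteq\mathcal C^{\perp}$ by Steane's enlargement: it is a stabilizer code whose stabilizer is the symplectic dual of $\{(u+e\mid v+Ae):u,v\in\widetilde{\mathcal C}^{\perp},\ e\in E\}$, where $E$ is a complement of $\widetilde{\mathcal C}^{\perp}$ in $\mathcal C^{\perp}$, $\dim E\ge2$, and $A$ is an endomorphism of $E$ without eigenvectors over $\mathbb F_3$. Its minimum distance is exactly $3$, and it is at least almost optimal: either there is no $[[L,L-2n+2,4]]_3$ quantum code, or there is one but no $[[L,L-2n+2,5]]_3$ quantum code. Here an $[[L,k,d]]_3$ quantum code is a $3^k$-dimensional subspace $Q$ of $\mathbb C^{3^L}$ ($k\ge1$) such that for every Pauli (Weyl) error $E$ of quantum weight $<d$ there is a constant $c_E$ with $\langle\varphi|E|\psi\rangle=c_E\langle\varphi|\psi\rangle$ for all $\varphi,\psi\in Q$, and a code of minimum distance $3$ is pure if $\langle\varphi|E|\psi\rangle=0$ on $Q$ for all errors $E$ of weight $1$ or $2$. -/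

import Mathlib

open scoped BigOperators

noncomputable section

/-! ### Walsh transform and plateaued functions on `𝔽_p^ι` (standard inner product `⬝ᵥ`) -/

section Plateaued

variable {p : ℕ} [Fact p.Prime] {ι : Type} [Fintype ι] [DecidableEq ι]

/-- The Walsh transform `∑ x, ξ_p ^ (f x - ⟨α, x⟩)`, where `ξ_p = exp (2πi/p)`. -/
def walsh (f : (ι → ZMod p) → ZMod p) (α : ι → ZMod p) : ℂ :=
  ∑ x : ι → ZMod p, ZMod.stdAddChar (N := p) (f x - α ⬝ᵥ x)

/-- `f` is `s`-plateaued: `|walsh f α|` is `0` or `p ^ ((n + s) / 2)`, where `n` is the dimension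
of the domain and `0 ≤ s ≤ n`. -/
def IsPlateaued (f : (ι → ZMod p) → ZMod p) (s : ℕ) : Prop :=
  s ≤ Fintype.card ι ∧
    ∀ α, ‖walsh f α‖ = 0 ∨ ‖walsh f α‖ = Real.sqrt ((p : ℝ) ^ (Fintype.card ι + s))

/-- A bent function is a `0`-plateaued function. -/
def IsBent (f : (ι → ZMod p) → ZMod p) : Prop := IsPlateaued f 0

/-- Weak regularity of an `s`-plateaued function: on the Walsh support,
`walsh f α = ε p ^ ((n + s) / 2) ξ_p ^ (f* α)` with `ε ∈ {±1, ±i}` independent of `α`. -/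
def IsWeaklyRegular (f : (ι → ZMod p) → ZMod p) (s : ℕ) : Prop :=
  ∃ (ε : ℂ) (fd : (ι → ZMod p) → ZMod p),
    (ε = 1 ∨ ε = -1 ∨ ε = Complex.I ∨ ε = -Complex.I) ∧
    ∀ α, walsh f α ≠ 0 →
      walsh f α =
        ε * (Real.sqrt ((p : ℝ) ^ (Fintype.card ι + s)) : ℂ) * ZMod.stdAddChar (N := p) (fd α)

/-- `f` is an `l`-form: `f (c x) = c ^ l f x` for all `c ≠ 0`. -/
def IsForm (f : (ι → ZMod p) → ZMod p) (l : ℕ) : Prop :=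
  ∀ (c : ZMod p) (x : ι → ZMod p), c ≠ 0 → f (c • x) = c ^ l * f x

/-- The sign convention: `μ = 1` if `p ^ m ≡ 1 (mod 4)`, and `μ = i` otherwise (`p` odd). -/
def signUnit (p m : ℕ) : ℂ := if p ^ m % 4 = 1 then 1 else Complex.I

/-- The (unbalanced) `s`-plateaued function `f` has type `ε ∈ {1, -1}`, that is, `ε₀ = ε`:
`walsh f 0 = ε μ p ^ ((n + s) / 2) ξ_p ^ j` for some `j` (the value at `0` of the dual of `f`). -/
def HasType (f : (ι → ZMod p) → ZMod p) (s : ℕ) (ε : ℤ) : Prop :=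
  (ε = 1 ∨ ε = -1) ∧ ∃ j : ZMod p,
    walsh f 0 = (ε : ℂ) * signUnit p (Fintype.card ι + s) *
      (Real.sqrt ((p : ℝ) ^ (Fintype.card ι + s)) : ℂ) * ZMod.stdAddChar (N := p) j

/-- The coordinates `(x, y, z, u)` of `𝔽_p^n₁ × 𝔽_p^n₂ × 𝔽_p^n₂ × 𝔽_p^s`. -/
abbrev GMMIndex (n₁ n₂ s : ℕ) : Type := Fin n₁ ⊕ Fin n₂ ⊕ Fin n₂ ⊕ Fin s

/-- The function `f (x, y, z, u) = g z x + ∑ i, y i * z i`. -/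
def gmmFun {n₁ n₂ : ℕ} (s : ℕ) (g : (Fin n₂ → ZMod p) → (Fin n₁ → ZMod p) → ZMod p)
    (v : GMMIndex n₁ n₂ s → ZMod p) : ZMod p :=
  g (fun i => v (Sum.inr (Sum.inr (Sum.inl i)))) (fun i => v (Sum.inl i)) +
    ∑ i : Fin n₂, v (Sum.inr (Sum.inl i)) * v (Sum.inr (Sum.inr (Sum.inl i)))

/-- The admissible families: each `g z` is a `2`-form weakly regular bent function that vanishes
at `0`, and `g (c z) = g z` for every nonzero scalar `c`. -/
def IsAdmissibleFamily {n₁ n₂ : ℕ} (g : (Fin n₂ → ZMod p) → (Fin n₁ → ZMod p) → ZMod p) : Prop :=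
  ∀ z, IsForm (g z) 2 ∧ IsBent (g z) ∧ IsWeaklyRegular (g z) 0 ∧ g z 0 = 0 ∧
    ∀ c : ZMod p, c ≠ 0 → g (c • z) = g z

/-- `x₁, …, x_L` enumerates (without repetition) a set `D` of representatives, up to nonzero
scalars, of the nonzero zeros of `f`: the sets `a D`, `a ≠ 0`, partition `{v ≠ 0 | f v = 0}`. -/
def IsZeroTransversal (f : (ι → ZMod p) → ZMod p) {L : ℕ} (x : Fin L → ι → ZMod p) : Prop :=
  (∀ i, x i ≠ 0 ∧ f (x i) = 0) ∧
    ∀ v : ι → ZMod p, v ≠ 0 → f v = 0 →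
      ∃! q : Fin L × (ZMod p)ˣ, v = (q.2 : ZMod p) • x q.1

/-- The defining-set code `{(⟨a, x₁⟩, …, ⟨a, x_L⟩) | a}`. -/
def definingSetCode {L : ℕ} (x : Fin L → ι → ZMod p) : Submodule (ZMod p) (Fin L → ZMod p) :=
  LinearMap.range (Matrix.mulVecLin (Matrix.of x))

end Plateaued

/-! ### Linear codes and quantum codes -/

section Codes

variable {p : ℕ} [Fact p.Prime] {L : ℕ}

/-- The dual code. -/
def dualCode (C : Submodule (ZMod p) (Fin L → ZMod p)) : Submodule (ZMod p) (Fin L → ZMod p) where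
  carrier := {y | ∀ c ∈ C, y ⬝ᵥ c = 0}
  add_mem' := by
    intro a b ha hb c hc
    rw [add_dotProduct, ha c hc, hb c hc, add_zero]
  zero_mem' := by
    intro c _
    exact zero_dotProduct c
  smul_mem' := by
    intro r a ha c hc
    rw [smul_dotProduct, ha c hc, smul_zero]

/-- The Hilbert space `(ℂ^p)^{⊗ L} = ℂ^(p^L)`, with orthonormal basis indexed by `𝔽_p^L`. -/
abbrev QState (p L : ℕ) [Fact p.Prime] : Type := EuclideanSpace ℂ (Fin L → ZMod p)

/-- The error operator `Z(b) X(a)`, which maps `|x⟩` to `ξ_p ^ (b ⬝ (x + a)) |x + a⟩`. -/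
def pauli (a b : Fin L → ZMod p) : QState p L →ₗ[ℂ] QState p L where
  toFun φ := WithLp.toLp 2 fun x => ZMod.stdAddChar (N := p) (b ⬝ᵥ x) * φ (x - a)
  map_add' φ ψ := by
    ext x
    simp [mul_add]
  map_smul' c φ := by
    ext x
    simp [mul_left_comm]

/-- The quantum weight of `Z(b) X(a)`: the number of positions on which it acts nontrivially. -/
def quantumWeight (a b : Fin L → ZMod p) : ℕ :=
  (Finset.univ.filter fun i => a i ≠ 0 ∨ b i ≠ 0).card

/-- `Q` detects the operator `E`: `⟨φ|E|ψ⟩ = c ⟨φ|ψ⟩` on `Q` for a constant `c`. -/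
def Detects (Q : Submodule ℂ (QState p L)) (E : QState p L →ₗ[ℂ] QState p L) : Prop :=
  ∃ c : ℂ, ∀ φ ∈ Q, ∀ ψ ∈ Q, inner ℂ φ (E ψ) = c * inner ℂ φ ψ

/-- `Q` is an `[[L, k, d]]_p` quantum code: a subspace of dimension `p ^ k` (with `k ≥ 1`) that
detects all errors of quantum weight less than `d` (minimum distance at least `d`). Neither
purity nor a stabilizer structure is required. -/
def IsQuantumCode (k d : ℕ) (Q : Submodule ℂ (QState p L)) : Prop :=
  1 ≤ k ∧ Module.finrank ℂ Q = p ^ k ∧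
    ∀ a b : Fin L → ZMod p, quantumWeight a b < d → Detects Q (pauli a b)

/-- The minimum distance of `Q` is at most `d`: some error of quantum weight `d` is undetectable. -/
def QDistLE (d : ℕ) (Q : Submodule ℂ (QState p L)) : Prop :=
  ∃ a b : Fin L → ZMod p, quantumWeight a b = d ∧ ¬ Detects Q (pauli a b)

/-- Purity up to `d`: `⟨φ|E|ψ⟩ = 0` on `Q` for all errors `E` of weight between `1` and `d - 1`. -/
def IsPure (d : ℕ) (Q : Submodule ℂ (QState p L)) : Prop :=
  ∀ a b : Fin L → ZMod p, 1 ≤ quantumWeight a b → quantumWeight a b < d →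
    ∀ φ ∈ Q, ∀ ψ ∈ Q, inner ℂ φ (pauli a b ψ) = 0

/-- An `[[L, k, d]]_p` quantum code `Q` is optimal if there is no `[[L, k, d + 1]]_p` quantum
code. -/
def IsOptimalQ (k d : ℕ) (Q : Submodule ℂ (QState p L)) : Prop :=
  IsQuantumCode k d Q ∧ ¬ ∃ Q' : Submodule ℂ (QState p L), IsQuantumCode k (d + 1) Q'

/-- An `[[L, k, d]]_p` quantum code `Q` is almost optimal if there is an optimal
`[[L, k, d + 1]]_p` quantum code. -/
def IsAlmostOptimalQ (k d : ℕ) (Q : Submodule ℂ (QState p L)) : Prop :=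
  IsQuantumCode k d Q ∧ ∃ Q' : Submodule ℂ (QState p L), IsOptimalQ k (d + 1) Q'

/-- `Q` is a stabilizer code with stabilizer `S` (up to phases): a nonzero joint eigenspace of the
operators `Z(b) X(a)`, `(a, b) ∈ S`. -/
def IsStabilizerCode (S : Set ((Fin L → ZMod p) × (Fin L → ZMod p)))
    (Q : Submodule ℂ (QState p L)) : Prop :=
  Q ≠ ⊥ ∧ ∃ χ : (Fin L → ZMod p) × (Fin L → ZMod p) → ℂ,
    ∀ φ, φ ∈ Q ↔ ∀ w ∈ S, pauli w.1 w.2 φ = χ w • φ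

/-- The symplectic dual of a set of pairs, for `⟨(a, b), (a', b')⟩ = a ⬝ b' - a' ⬝ b`. -/
def symplecticDual (N : Set ((Fin L → ZMod p) × (Fin L → ZMod p))) :
    Set ((Fin L → ZMod p) × (Fin L → ZMod p)) :=
  {w | ∀ m ∈ N, w.1 ⬝ᵥ m.2 - m.1 ⬝ᵥ w.2 = 0}

/-- `Q` arises by Steane's enlargement from `C₁^⊥ ⊆ C₁ ⊆ C₂` with `dim C₂ ≥ dim C₁ + 2`: for a
complement `E` of `C₁` in `C₂` and an endomorphism `A` of `E` without eigenvectors over `𝔽_p`,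
`Q` is a stabilizer code whose stabilizer is the symplectic dual of
`{(u + e, v + A e) | u, v ∈ C₁, e ∈ E}`. -/
def IsSteaneEnlargement (C₁ C₂ : Submodule (ZMod p) (Fin L → ZMod p))
    (Q : Submodule ℂ (QState p L)) : Prop :=
  dualCode C₁ ≤ C₁ ∧ C₁ ≤ C₂ ∧
    Module.finrank (ZMod p) C₁ + 2 ≤ Module.finrank (ZMod p) C₂ ∧
    ∃ (E : Submodule (ZMod p) (Fin L → ZMod p)) (A : E →ₗ[ZMod p] E),
      Disjoint C₁ E ∧ C₁ ⊔ E = C₂ ∧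
      (∀ (r : ZMod p) (e : E), A e = r • e → e = 0) ∧
      IsStabilizerCode
        (symplecticDual {w | ∃ u ∈ C₁, ∃ v ∈ C₁, ∃ e : E,
          w = (u + (e : Fin L → ZMod p), v + (A e : Fin L → ZMod p))}) Q

end Codes

/-- From the function `f` one obtains, by Steane's enlargement of the dual of the code `C̃` of a
transversal of the nonzero zeros of `f` to the dual of a subcode `C` of `C̃`, a pure ternary
`[[L, k, 3]]` quantum code of minimum distance exactly `3` that is optimal or almost optimal. -/
def YieldsTernaryQuantumCode {ι : Type} [Fintype ι] [DecidableEq ι]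
    (f : (ι → ZMod 3) → ZMod 3) (L k : ℕ) : Prop :=
  ∃ (x : Fin L → ι → ZMod 3) (C : Submodule (ZMod 3) (Fin L → ZMod 3))
    (Q : Submodule ℂ (QState 3 L)),
    IsZeroTransversal f x ∧ C ≤ definingSetCode x ∧
    IsSteaneEnlargement (dualCode (definingSetCode x)) (dualCode C) Q ∧
    IsQuantumCode k 3 Q ∧ QDistLE 3 Q ∧ IsPure 3 Q ∧
    (IsOptimalQ k 3 Q ∨ IsAlmostOptimalQ k 3 Q)

end

/-! Constant families suffice: each `g z` is the same diagonal form in one or two variables, so f is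
a quadratic form of rank n - s whose radical consists of the u-coordinates. Its Walsh transform is a
product of Gauss sums, which gives the plateaued property, the type and the number of zeros, hence
L.

View the representatives x_i as points of a quadric, and let ∑ y_i x_i be the syndrome of a word y.
The code of these points is self-orthogonal by a Chevalley–Warning argument
(`IsZeroTransversal.sum_dotProduct_mul`): over 𝔽₃ the indicator of the zeros is 1 - f², and a
polynomial of degree at most 6 sums to 0 over 𝔽₃ⁿ when n ≥ 4. The vectors v₁ = e_x and v₂ = e_y +
e_z span a plane on which f is a² + b². This form is anisotropic because -1 is not a square, so no
x_i lies in the plane. Steane's complement E is a lift of this plane, and A lifts the rotation v₁ ↦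
v₂ ↦ -v₁, which has no eigenvector for the same reason.

A pair in the enlarged code has syndromes q and Jq, with q in the plane and J the rotation. If its
weight is at most 2 and q ≠ 0, then q and Jq form a basis of the plane inside the span of at most
two points, so those points would lie in the plane, which is impossible. If q = 0, pairwise
independence of the points makes the pair zero. This is the content of `two_point` and
`eq_zero_of_quantumWeight_lt`, and gives purity and distance at least 3. The plane lies in the span
of three points of the quadric, which produces an undetectable error of weight 3. The dimension is
the trace of the projector onto the fixed space of the stabilizer (`finrank_fixedCode_mul`).

For almost optimality it is enough to exclude distance 5, among all codes, degenerate and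
non-stabilizer ones included. For a code with projector P the function |tr(P E)|² is, on detectable
errors E, proportional to its own character transform. Testing this against the errors of weight 2
forces it to vanish at the identity, which is absurd (`eq_zero_of_character_sum_large`,
`not_isQuantumCode_five`). The numerical condition is `hamming_inequality`. -/

/-! ### Additive characters and Plancherel's identity -/

section Characters

variable {p : ℕ} [Fact p.Prime] {ι : Type} [Fintype ι] [DecidableEq ι]

lemma conj_stdAddChar (a : ZMod p) :
    (starRingEnd ℂ) (ZMod.stdAddChar (N := p) a) = ZMod.stdAddChar (N := p) (-a) := by
  rw [AddChar.map_neg_eq_conj]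

lemma stdAddChar_mul_conj (a : ZMod p) :
    ZMod.stdAddChar (N := p) a * (starRingEnd ℂ) (ZMod.stdAddChar (N := p) a) = 1 := by
  rw [conj_stdAddChar, ← AddChar.map_add_eq_mul, add_neg_cancel, AddChar.map_zero_eq_one]

lemma stdAddChar_eq_one_iff (a : ZMod p) : ZMod.stdAddChar (N := p) a = 1 ↔ a = 0 := by
  rw [← (ZMod.stdAddChar (N := p)).map_zero_eq_one, ZMod.injective_stdAddChar.eq_iff]

lemma sum_stdAddChar_mul (c : ZMod p) :
    ∑ a : ZMod p, ZMod.stdAddChar (N := p) (c * a) = if c = 0 then (p : ℂ) else 0 := by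
  have := AddChar.sum_mulShift c (ZMod.isPrimitive_stdAddChar p)
  simp only [ZMod.card] at this
  simp_rw [mul_comm c]
  rw [this]; split_ifs <;> simp

lemma stdAddChar_sum {κ : Type} (s : Finset κ) (h : κ → ZMod p) :
    ZMod.stdAddChar (N := p) (∑ i ∈ s, h i) = ∏ i ∈ s, ZMod.stdAddChar (N := p) (h i) :=
  map_prod (ZMod.stdAddChar (N := p)).toMonoidHom (fun i => Multiplicative.ofAdd (h i)) s

/-- The character sum over a product of copies of `ZMod p` of a product of functions of the
coordinates is the product of the sums. -/
lemma sum_stdAddChar_sum {α : Type} [Fintype α] (h : ι → α → ZMod p) :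
    ∑ x : ι → α, ZMod.stdAddChar (N := p) (∑ i, h i (x i)) =
      ∏ i, ∑ a : α, ZMod.stdAddChar (N := p) (h i a) := by
  rw [Finset.prod_univ_sum, Fintype.piFinset_univ]
  refine Finset.sum_congr rfl fun x _ => ?_
  exact stdAddChar_sum _ _

lemma sum_stdAddChar_dotProduct (c : ι → ZMod p) :
    ∑ x : ι → ZMod p, ZMod.stdAddChar (N := p) (c ⬝ᵥ x) =
      if c = 0 then (p : ℂ) ^ Fintype.card ι else 0 := by
  have := sum_stdAddChar_sum (p := p) (fun (i : ι) (a : ZMod p) => c i * a)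
  simp only [dotProduct]
  rw [this]
  simp_rw [sum_stdAddChar_mul]
  split_ifs with h
  · simp [h]
  · obtain ⟨i, hi⟩ := Function.ne_iff.1 h
    exact Finset.prod_eq_zero (Finset.mem_univ i) (if_neg hi)

/-- Plancherel's identity for `F` and `G` on `(ZMod p) ^ ι`. -/
lemma sum_fourier_mul_conj (F G : (ι → ZMod p) → ℂ) :
    ∑ b : ι → ZMod p, (∑ x, ZMod.stdAddChar (N := p) (b ⬝ᵥ x) * F x) *
        (starRingEnd ℂ) (∑ x, ZMod.stdAddChar (N := p) (b ⬝ᵥ x) * G x) =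
      (p : ℂ) ^ Fintype.card ι * ∑ x, F x * (starRingEnd ℂ) (G x) := by
  have h1 : ∀ b : ι → ZMod p, (∑ x, ZMod.stdAddChar (N := p) (b ⬝ᵥ x) * F x) *
        (starRingEnd ℂ) (∑ x, ZMod.stdAddChar (N := p) (b ⬝ᵥ x) * G x) =
      ∑ x, ∑ y, ZMod.stdAddChar (N := p) ((x - y) ⬝ᵥ b) * (F x * (starRingEnd ℂ) (G y)) := by
    intro b
    rw [map_sum, Finset.sum_mul_sum]
    refine Finset.sum_congr rfl fun x _ => Finset.sum_congr rfl fun y _ => ?_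
    rw [map_mul, conj_stdAddChar, dotProduct_comm (x - y), dotProduct_sub, sub_eq_add_neg,
      AddChar.map_add_eq_mul]
    ring
  simp_rw [h1]
  rw [Finset.sum_comm, Finset.mul_sum]
  refine Finset.sum_congr rfl fun x _ => ?_
  rw [Finset.sum_comm, Finset.sum_eq_single x]
  · rw [← Finset.sum_mul, sum_stdAddChar_dotProduct, if_pos (sub_self x)]
  · intro y _ hy
    rw [← Finset.sum_mul, sum_stdAddChar_dotProduct, if_neg (sub_ne_zero.2 hy.symm), zero_mul]
  · simp

end Characters

/-! ### Composition, commutation and orthogonality of the error operators -/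

section Pauli

variable {p : ℕ} [Fact p.Prime] {L : ℕ}

lemma pauli_apply (a b : Fin L → ZMod p) (φ : QState p L) (x : Fin L → ZMod p) :
    pauli a b φ x = ZMod.stdAddChar (N := p) (b ⬝ᵥ x) * φ (x - a) := rfl

lemma pauli_zero (φ : QState p L) : pauli 0 0 φ = φ := by
  ext x; simp [pauli_apply]

lemma pauli_pauli (a b a' b' : Fin L → ZMod p) (φ : QState p L) :
    pauli a b (pauli a' b' φ) =
      ZMod.stdAddChar (N := p) (-(b' ⬝ᵥ a)) • pauli (a + a') (b + b') φ := by
  ext x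
  simp only [pauli_apply, PiLp.smul_apply, smul_eq_mul, sub_sub]
  rw [← mul_assoc, ← mul_assoc, ← AddChar.map_add_eq_mul, ← AddChar.map_add_eq_mul]
  congr 2
  rw [dotProduct_sub, add_dotProduct]; ring

lemma pauli_comm (a b a' b' : Fin L → ZMod p) (φ : QState p L) :
    pauli a b (pauli a' b' φ) =
      ZMod.stdAddChar (N := p) (a' ⬝ᵥ b - a ⬝ᵥ b') • pauli a' b' (pauli a b φ) := by
  rw [pauli_pauli, pauli_pauli, smul_smul, ← AddChar.map_add_eq_mul, add_comm a', add_comm b',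
    dotProduct_comm b', dotProduct_comm b]
  congr 2
  ring

lemma inner_eq_sum (φ ψ : QState p L) :
    inner ℂ φ ψ = ∑ x, (starRingEnd ℂ) (φ x) * ψ x := by
  rw [PiLp.inner_apply]
  refine Finset.sum_congr rfl fun x _ => ?_
  rw [RCLike.inner_apply, mul_comm]

lemma inner_pauli_pauli (a b : Fin L → ZMod p) (φ ψ : QState p L) :
    inner ℂ (pauli a b φ) (pauli a b ψ) = inner ℂ φ ψ := by
  rw [inner_eq_sum, inner_eq_sum,
    ← Equiv.sum_comp (Equiv.subRight a) fun x => (starRingEnd ℂ) (φ x) * ψ x]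
  refine Finset.sum_congr rfl fun x _ => ?_
  simp only [pauli_apply, map_mul, Equiv.subRight_apply]
  linear_combination (starRingEnd ℂ) (φ (x - a)) * ψ (x - a) *
    stdAddChar_mul_conj (p := p) (b ⬝ᵥ x)

lemma inner_pauli (a b : Fin L → ZMod p) (φ ψ : QState p L) :
    inner ℂ φ (pauli a b ψ) =
      ∑ x, ZMod.stdAddChar (N := p) (b ⬝ᵥ x) * ((starRingEnd ℂ) (φ x) * ψ (x - a)) := by
  rw [inner_eq_sum]
  refine Finset.sum_congr rfl fun x _ => ?_
  rw [pauli_apply]; ring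

/-- The error operators form an orthogonal basis of the operators on the state space. -/
lemma sum_inner_pauli_mul_conj (φ ψ φ' ψ' : QState p L) :
    ∑ w : (Fin L → ZMod p) × (Fin L → ZMod p),
        inner ℂ φ (pauli w.1 w.2 ψ) * (starRingEnd ℂ) (inner ℂ φ' (pauli w.1 w.2 ψ')) =
      (p : ℂ) ^ L * (inner ℂ φ φ' * inner ℂ ψ' ψ) := by
  rw [Fintype.sum_prod_type]
  -- For fixed a the sum over b is Plancherel in x. The sum over a then decouples after replacing a
  -- by x - y.
  simp_rw [inner_pauli, sum_fourier_mul_conj, ← Finset.mul_sum, Fintype.card_fin]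
  congr 1
  rw [Finset.sum_comm, inner_eq_sum, Finset.sum_mul]
  refine Finset.sum_congr rfl fun x _ => ?_
  rw [inner_eq_sum, Finset.mul_sum, ← Equiv.sum_comp (Equiv.subLeft x)]
  refine Finset.sum_congr rfl fun y _ => ?_
  simp only [Equiv.subLeft_apply, map_mul, Complex.conj_conj, sub_sub_cancel]
  ring

end Pauli

/-! ### A linear programming bound -/

section LinearProgramming

/-- A linear programming bound: a nonnegative function `μ` which is, on `W`, proportional to its
own character transform vanishes on `W` if `W` contains the differences of a set `B` whose
character sums are large on `W`. -/
lemma eq_zero_of_character_sum_large {V : Type*} [AddCommGroup V] [Fintype V] [DecidableEq V]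
    (ω : V → V → ℂ) (hω : ∀ e d d', ω e (d - d') = ω e d * (starRingEnd ℂ) (ω e d'))
    (μ : V → ℝ) (hμ : ∀ e, 0 ≤ μ e) (W B : Finset V) (hB : ∀ d ∈ B, ∀ d' ∈ B, d - d' ∈ W)
    (r : ℝ) (hr : 0 ≤ r) (hI : ∀ d ∈ W, ∑ e, ω e d * (μ e : ℂ) = (r * μ d : ℝ))
    (G : V → ℝ) (hG : ∀ e, ∑ d ∈ B, ω e d = G e) (hW : ∀ e ∈ W, r * B.card < G e ^ 2)
    (e₀ : V) (he₀ : e₀ ∈ W) : μ e₀ = 0 := by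
  -- Since ω e is a character, G² is the double sum of ω e (d - d'). Each difference lies in W,
  -- where the transform of μ is known.
  have h1 : ∑ e, G e ^ 2 * μ e = ∑ d ∈ B, ∑ d' ∈ B, r * μ (d - d') := by
    rw [← Complex.ofReal_inj]
    push_cast
    have : ∀ d ∈ B, ∀ d' ∈ B, (r : ℂ) * (μ (d - d') : ℂ) =
        ∑ e, ω e d * (starRingEnd ℂ) (ω e d') * (μ e : ℂ) := by
      intro d hd d' hd'
      have := hI _ (hB d hd d' hd')
      push_cast at this
      rw [← this]
      exact Finset.sum_congr rfl fun e _ => by rw [hω]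
    rw [Finset.sum_congr rfl fun d hd => Finset.sum_congr rfl fun d' hd' => this d hd d' hd']
    have h2 : ∀ e, (G e : ℂ) ^ 2 * (μ e : ℂ) =
        ∑ d ∈ B, ∑ d' ∈ B, ω e d * (starRingEnd ℂ) (ω e d') * (μ e : ℂ) := by
      intro e
      have h3 : (starRingEnd ℂ) (G e : ℂ) = G e := Complex.conj_ofReal _
      rw [sq]
      nth_rewrite 2 [← h3]
      rw [← hG, map_sum, Finset.sum_mul_sum, Finset.sum_mul]
      exact Finset.sum_congr rfl fun d _ => Finset.sum_mul _ _ _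
    simp_rw [h2]
    rw [Finset.sum_comm]
    refine Finset.sum_congr rfl fun d _ => ?_
    rw [Finset.sum_comm]
  -- For fixed d the differences d - d' are distinct elements of W, so each inner sum is at most the
  -- total mass of μ on W.
  have h2 : ∑ d ∈ B, ∑ d' ∈ B, r * μ (d - d') ≤ r * B.card * ∑ e ∈ W, μ e := by
    have : ∀ d ∈ B, ∑ d' ∈ B, r * μ (d - d') ≤ r * ∑ e ∈ W, μ e := by
      intro d hd
      rw [← Finset.mul_sum]
      refine mul_le_mul_of_nonneg_left ?_ hr
      rw [← Finset.sum_image (f := μ) (g := fun d' => d - d')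
        (fun a _ b _ hab => sub_right_injective hab)]
      refine Finset.sum_le_sum_of_subset_of_nonneg ?_ fun e _ _ => hμ e
      intro e he
      obtain ⟨d', hd', rfl⟩ := Finset.mem_image.1 he
      exact hB d hd d' hd'
    refine (Finset.sum_le_sum this).trans ?_
    rw [Finset.sum_const, nsmul_eq_mul]
    exact le_of_eq (by ring)
  have h3 : ∑ e ∈ W, G e ^ 2 * μ e ≤ ∑ e, G e ^ 2 * μ e :=
    Finset.sum_le_sum_of_subset_of_nonneg (Finset.subset_univ _)
      fun e _ _ => mul_nonneg (sq_nonneg _) (hμ e)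
  by_contra h0
  have h4 : r * B.card * ∑ e ∈ W, μ e < ∑ e ∈ W, G e ^ 2 * μ e := by
    rw [Finset.mul_sum]
    refine Finset.sum_lt_sum (fun e he => mul_le_mul_of_nonneg_right (hW e he).le (hμ e))
      ⟨e₀, he₀, mul_lt_mul_of_pos_right (hW e₀ he₀) (lt_of_le_of_ne (hμ e₀) (Ne.symm h0))⟩
  linarith

end LinearProgramming

/-! ### Sums over vectors of weight two -/

section WeightTwo

/-- Newton's identity p₁² = p₂ + 2e₂. The two-element subsets in e₂ will be the supports of the
vectors of weight two. -/
lemma sq_sum_eq_sum_sq_add {ι R : Type*} [DecidableEq ι] [CommRing R] (s : Finset ι) (t : ι → R) :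
    (∑ i ∈ s, t i) ^ 2 = ∑ i ∈ s, t i ^ 2 + 2 * ∑ T ∈ s.powersetCard 2, ∏ i ∈ T, t i := by
  induction s using Finset.induction_on with
  | empty => rw [Finset.powersetCard_eq_empty.2 (by simp)]; simp
  | insert a s ha ih =>
    have hd : Disjoint (s.powersetCard 2) ((s.powersetCard 1).image (insert a)) := by
      rw [Finset.disjoint_left]
      intro T hT hT'
      obtain ⟨U, -, rfl⟩ := Finset.mem_image.1 hT'
      exact ha ((Finset.mem_powersetCard.1 hT).1 (Finset.mem_insert_self a U))
    rw [Finset.sum_insert ha, Finset.sum_insert ha, Finset.powersetCard_succ_insert ha,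
      Finset.sum_union hd, Finset.sum_image, Finset.powersetCard_one, Finset.sum_map]
    · have : ∀ i ∈ s, ∏ j ∈ insert a ({i} : Finset ι), t j = t a * t i := by
        intro i hi
        rw [Finset.prod_insert, Finset.prod_singleton]
        rintro h
        exact ha (Finset.mem_singleton.1 h ▸ hi)
      simp only [Function.Embedding.coeFn_mk]
      rw [Finset.sum_congr rfl this, ← Finset.mul_sum]
      linear_combination ih
    · intro U hU U' hU' h
      have h1 : a ∉ U := fun h => ha ((Finset.mem_powersetCard.1 hU).1 h)
      have h2 : a ∉ U' := fun h => ha ((Finset.mem_powersetCard.1 hU').1 h)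
      rw [← Finset.erase_insert h1, ← Finset.erase_insert h2, h]

/-- The sum of a product function over the vectors with exactly two nonzero coordinates. -/
lemma two_mul_sum_prod_weight_two {ι A R : Type*} [Fintype ι] [DecidableEq ι] [Fintype A]
    [DecidableEq A] [Zero A] [CommRing R] (ψ : ι → A → R) (h0 : ∀ i, ψ i 0 = 1) :
    2 * ∑ d : ι → A with (Finset.univ.filter fun i => d i ≠ 0).card = 2, ∏ i, ψ i (d i) =
      (∑ i, ∑ a ∈ Finset.univ.erase (0 : A), ψ i a) ^ 2 -
        ∑ i, (∑ a ∈ Finset.univ.erase (0 : A), ψ i a) ^ 2 := by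
  -- Group the vectors by support T. Over a fixed T the coordinates run independently through the
  -- nonzero values, so the sum factorizes.
  have h1 : ∑ d : ι → A with (Finset.univ.filter fun i => d i ≠ 0).card = 2, ∏ i, ψ i (d i) =
      ∑ T ∈ Finset.univ.powersetCard 2, ∏ i ∈ T, ∑ a ∈ Finset.univ.erase (0 : A), ψ i a := by
    rw [← Finset.sum_fiberwise_of_maps_to (t := Finset.univ.powersetCard 2)
      (g := fun d : ι → A => Finset.univ.filter fun i => d i ≠ 0)]
    · refine Finset.sum_congr rfl fun T hT => ?_
      have hset : (Finset.univ.filter fun d : ι → A =>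
            (Finset.univ.filter fun i => d i ≠ 0).card = 2).filter
            (fun d => (Finset.univ.filter fun i => d i ≠ 0) = T) =
          Fintype.piFinset fun i => if i ∈ T then Finset.univ.erase (0 : A) else {0} := by
        ext d
        simp only [Finset.mem_filter, Finset.mem_univ, true_and, Fintype.mem_piFinset]
        constructor
        · rintro ⟨-, rfl⟩ i
          by_cases hi : d i = 0 <;> simp [hi]
        · intro h
          have : (Finset.univ.filter fun i => d i ≠ 0) = T := by
            ext i
            have := h i
            by_cases hi : i ∈ T <;> simp_all
          exact ⟨by rw [this]; exact (Finset.mem_powersetCard.1 hT).2, this⟩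
      rw [hset, ← Finset.prod_univ_sum]
      rw [← Finset.prod_subset (Finset.subset_univ T)]
      · exact Finset.prod_congr rfl fun i hi => by rw [if_pos hi]
      · intro i _ hi
        rw [if_neg hi, Finset.sum_singleton, h0]
    · intro d hd
      simpa [Finset.mem_powersetCard] using hd
  rw [h1, sq_sum_eq_sum_sq_add]
  ring

end WeightTwo

/-! ### Quantum MacWilliams identity and exclusion of distance five -/

section QuantumBound

variable {p : ℕ} [Fact p.Prime] {L : ℕ}

/-- The quantum MacWilliams identity for the trace of a projected error. -/
lemma sum_stdAddChar_mul_norm_sq_trace {K : ℕ} (v : Fin K → QState p L) (hv : Orthonormal ℂ v)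
    (a b : Fin L → ZMod p) (c : ℂ)
    (hc : ∀ k l, inner ℂ (v l) (pauli a b (v k)) = c * inner ℂ (v l) (v k)) :
    K * ∑ w : (Fin L → ZMod p) × (Fin L → ZMod p),
        ZMod.stdAddChar (N := p) (a ⬝ᵥ w.2 - w.1 ⬝ᵥ b) *
          ((‖∑ k, inner ℂ (v k) (pauli w.1 w.2 (v k))‖ ^ 2 : ℝ) : ℂ) =
      (p : ℂ) ^ L * ((‖∑ k, inner ℂ (v k) (pauli a b (v k))‖ ^ 2 : ℝ) : ℂ) := by
  have hin : ∀ k l, inner ℂ (v l) (v k) = if l = k then (1 : ℂ) else 0 :=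
    fun k l => orthonormal_iff_ite.1 hv l k
  -- The character value is the commutation phase of the two errors, so it is absorbed by
  -- conjugating with the unitary `pauli a b`.
  have h1 : ∀ w : (Fin L → ZMod p) × (Fin L → ZMod p),
      ZMod.stdAddChar (N := p) (a ⬝ᵥ w.2 - w.1 ⬝ᵥ b) *
          ((‖∑ k, inner ℂ (v k) (pauli w.1 w.2 (v k))‖ ^ 2 : ℝ) : ℂ) =
      ∑ k, ∑ l, inner ℂ (pauli a b (v k)) (pauli w.1 w.2 (pauli a b (v k))) *
        (starRingEnd ℂ) (inner ℂ (v l) (pauli w.1 w.2 (v l))) := by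
    intro w
    push_cast
    rw [← Complex.mul_conj', map_sum, Finset.sum_mul_sum, Finset.mul_sum]
    refine Finset.sum_congr rfl fun k _ => ?_
    rw [Finset.mul_sum]
    refine Finset.sum_congr rfl fun l _ => ?_
    rw [pauli_comm w.1 w.2 a b, inner_smul_right, inner_pauli_pauli]
    ring
  simp_rw [h1]
  rw [Finset.sum_comm]
  -- Orthogonality of the error operators turns the sum over w into |⟨v_l, E v_k⟩|² with E = `pauli
  -- a b`. Detectability leaves only l = k, with value |c|².
  have h2 : ∀ k : Fin K, ∑ w : (Fin L → ZMod p) × (Fin L → ZMod p), ∑ l : Fin K,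
      inner ℂ (pauli a b (v k)) (pauli w.1 w.2 (pauli a b (v k))) *
        (starRingEnd ℂ) (inner ℂ (v l) (pauli w.1 w.2 (v l))) =
      (p : ℂ) ^ L * (c * (starRingEnd ℂ) c) := by
    intro k
    rw [Finset.sum_comm]
    simp_rw [sum_inner_pauli_mul_conj]
    rw [← Finset.mul_sum, Finset.sum_eq_single k]
    · rw [← inner_conj_symm (pauli a b (v k)), hc, hin, if_pos rfl]
      simp [mul_comm]
    · intro l _ hl
      rw [hc, hin, if_neg hl]
      simp
    · simp
  simp_rw [h2]
  rw [Finset.sum_const, Finset.card_univ, Fintype.card_fin, nsmul_eq_mul]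
  have h3 : ∑ k, inner ℂ (v k) (pauli a b (v k)) = K * c := by
    rw [Finset.sum_congr rfl fun k _ => (hc k k)]
    simp_rw [hin]
    simp
  rw [h3]
  push_cast
  rw [← Complex.mul_conj']
  simp only [map_mul, Complex.conj_natCast]
  ring

lemma quantumWeight_sub_le (a b a' b' : Fin L → ZMod p) :
    quantumWeight (a - a') (b - b') ≤ quantumWeight a b + quantumWeight a' b' := by
  unfold quantumWeight
  refine (Finset.card_le_card ?_).trans (Finset.card_union_le _ _)
  intro i hi
  simp only [Finset.mem_filter, Finset.mem_univ, true_and, Finset.mem_union, Pi.sub_apply] at hi ⊢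
  by_contra h
  push Not at h
  obtain ⟨⟨h1, h2⟩, h3, h4⟩ := h
  simp [h1, h2, h3, h4] at hi

lemma quantumWeight_le (a b : Fin L → ZMod p) : quantumWeight a b ≤ L :=
  (Finset.card_filter_le _ _).trans (by simp)

/-- The full sum over 𝔽_p² is p² or 0 according to whether the character is trivial, and -1 removes
the identity. This is the contribution of one site to the weight-two sum. -/
lemma sum_erase_stdAddChar (α β : ZMod p) :
    ∑ d ∈ Finset.univ.erase (0 : ZMod p × ZMod p),
        ZMod.stdAddChar (N := p) (d.1 * β - α * d.2) =
      (if α ≠ 0 ∨ β ≠ 0 then 0 else (p : ℂ) ^ 2) - 1 := by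
  rw [Finset.sum_erase_eq_sub (Finset.mem_univ _), Fintype.sum_prod_type]
  simp only [Prod.fst_zero, Prod.snd_zero, zero_mul, mul_zero, sub_zero,
    AddChar.map_zero_eq_one, sub_left_inj]
  have : ∀ x y : ZMod p, ZMod.stdAddChar (N := p) (x * β - α * y) =
      ZMod.stdAddChar (N := p) (β * x) * ZMod.stdAddChar (N := p) ((-α) * y) := by
    intro x y
    rw [← AddChar.map_add_eq_mul]; congr 1; ring
  simp_rw [this, ← Finset.sum_mul_sum, sum_stdAddChar_mul, neg_eq_zero]
  by_cases h1 : α = 0 <;> by_cases h2 : β = 0 <;> simp [h1, h2, sq]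

/-- The character sum over the errors of weight two. -/
lemma two_mul_sum_weight_two (a b : Fin L → ZMod p) :
    2 * ∑ d : (Fin L → ZMod p) × (Fin L → ZMod p) with quantumWeight d.1 d.2 = 2,
        ZMod.stdAddChar (N := p) (d.1 ⬝ᵥ b - a ⬝ᵥ d.2) =
      (((p : ℂ) ^ 2 - 1) * L - (p : ℂ) ^ 2 * quantumWeight a b) ^ 2 -
        (((p : ℂ) ^ 2 - 1) ^ 2 * (L - quantumWeight a b) + quantumWeight a b) := by
  have h := two_mul_sum_prod_weight_two (ι := Fin L) (A := ZMod p × ZMod p) (R := ℂ)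
    (fun i d => ZMod.stdAddChar (N := p) (d.1 * b i - a i * d.2)) (by simp)
  simp_rw [sum_erase_stdAddChar] at h
  have hL : ((Finset.univ.filter fun i => ¬ (a i ≠ 0 ∨ b i ≠ 0)).card : ℂ) =
      L - quantumWeight a b := by
    rw [eq_sub_iff_add_eq, ← Nat.cast_add]
    unfold quantumWeight
    rw [add_comm, Finset.card_filter_add_card_filter_not, Finset.card_univ, Fintype.card_fin]
  have h1 : ∀ u v : ℂ, ∑ i : Fin L, (if a i ≠ 0 ∨ b i ≠ 0 then u else v) =
      quantumWeight a b * u + (L - quantumWeight a b) * v := by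
    intro u v
    rw [Finset.sum_ite, Finset.sum_const, Finset.sum_const, nsmul_eq_mul, nsmul_eq_mul, hL]
    rfl
  have h2 : ∑ i : Fin L, ((if a i ≠ 0 ∨ b i ≠ 0 then 0 else (p : ℂ) ^ 2) - 1) =
      ((p : ℂ) ^ 2 - 1) * L - (p : ℂ) ^ 2 * quantumWeight a b := by
    rw [Finset.sum_sub_distrib, h1]
    simp; ring
  have h3 : ∑ i : Fin L, ((if a i ≠ 0 ∨ b i ≠ 0 then 0 else (p : ℂ) ^ 2) - 1) ^ 2 =
      ((p : ℂ) ^ 2 - 1) ^ 2 * (L - quantumWeight a b) + quantumWeight a b := by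
    have : ∀ i : Fin L, ((if a i ≠ 0 ∨ b i ≠ 0 then 0 else (p : ℂ) ^ 2) - 1) ^ 2 =
        if a i ≠ 0 ∨ b i ≠ 0 then 1 else ((p : ℂ) ^ 2 - 1) ^ 2 := by
      intro i; split_ifs <;> ring
    simp_rw [this, h1]
    ring
  rw [h2, h3] at h
  rw [← h]
  congr 1
  refine Finset.sum_equiv (Equiv.arrowProdEquivProdArrow (Fin L) (fun _ => ZMod p)
    (fun _ => ZMod p)).symm ?_ ?_
  · intro d
    have : ∀ i, (d.1 i ≠ 0 ∨ d.2 i ≠ 0) ↔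
        ¬ (Equiv.arrowProdEquivProdArrow (Fin L) (fun _ => ZMod p)
          (fun _ => ZMod p)).symm d i = 0 := by
      intro i
      simp only [Equiv.arrowProdEquivProdArrow, Equiv.coe_fn_symm_mk, Prod.mk_eq_zero]
      tauto
    simp only [Finset.mem_filter, Finset.mem_univ, true_and, quantumWeight, ne_eq, ← this]
  · intro d _
    rw [← stdAddChar_sum, Finset.sum_sub_distrib]
    rfl

/-- A version of the quantum Hamming bound for codes of minimum distance `5` that need not be
pure. -/
theorem not_isQuantumCode_five {k m : ℕ} (hkm : k + m = L)
    (hbound : ∀ w : ℕ, w < 5 → w ≤ L → (p : ℝ) ^ m *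
        (((((p : ℝ) ^ 2 - 1) * L) ^ 2 - ((p : ℝ) ^ 2 - 1) ^ 2 * L) / 2) <
      (((((p : ℝ) ^ 2 - 1) * L - (p : ℝ) ^ 2 * w) ^ 2 -
        (((p : ℝ) ^ 2 - 1) ^ 2 * (L - w) + w)) / 2) ^ 2) (Q : Submodule ℂ (QState p L)) :
    ¬ IsQuantumCode k 5 Q := by
  rintro ⟨-, hdim, hdet⟩
  have hp : (0 : ℝ) < p := by exact_mod_cast (Fact.out : p.Prime).pos
  set K := Module.finrank ℂ Q with hK
  let v : Fin K → QState p L := fun i => (stdOrthonormalBasis ℂ Q i : QState p L)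
  have hv : Orthonormal ℂ v := (stdOrthonormalBasis ℂ Q).orthonormal.comp_linearIsometry
    Q.subtypeₗᵢ
  have hK0 : (0 : ℝ) < K := by rw [hdim]; push_cast; positivity
  -- μ is |tr(P E_w)|² for the projector P onto Q. Differences of elements of B have weight at most
  -- 4, hence lie in W, the set of errors that Q detects.
  let μ : (Fin L → ZMod p) × (Fin L → ZMod p) → ℝ := fun w =>
    ‖∑ k, inner ℂ (v k) (pauli w.1 w.2 (v k))‖ ^ 2
  let W : Finset ((Fin L → ZMod p) × (Fin L → ZMod p)) :=
    Finset.univ.filter fun d => quantumWeight d.1 d.2 < 5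
  let B : Finset ((Fin L → ZMod p) × (Fin L → ZMod p)) :=
    Finset.univ.filter fun d => quantumWeight d.1 d.2 = 2
  let ω : (Fin L → ZMod p) × (Fin L → ZMod p) → (Fin L → ZMod p) × (Fin L → ZMod p) → ℂ :=
    fun w d => ZMod.stdAddChar (N := p) (d.1 ⬝ᵥ w.2 - w.1 ⬝ᵥ d.2)
  let G : (Fin L → ZMod p) × (Fin L → ZMod p) → ℝ := fun w =>
    ((((p : ℝ) ^ 2 - 1) * L - (p : ℝ) ^ 2 * quantumWeight w.1 w.2) ^ 2 -
        (((p : ℝ) ^ 2 - 1) ^ 2 * (L - quantumWeight w.1 w.2) + quantumWeight w.1 w.2)) / 2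
  have hG : ∀ e, ∑ d ∈ B, ω e d = G e := by
    intro e
    have := two_mul_sum_weight_two e.1 e.2
    simp only [B, ω, G]
    push_cast
    rw [← this]; ring
  have hw0 : quantumWeight (0 : Fin L → ZMod p) 0 = 0 := by simp [quantumWeight]
  have hcard : (B.card : ℝ) =
      ((((p : ℝ) ^ 2 - 1) * L) ^ 2 - ((p : ℝ) ^ 2 - 1) ^ 2 * L) / 2 := by
    have := hG 0
    simp only [ω, G, Prod.fst_zero, Prod.snd_zero, hw0, dotProduct_zero, zero_dotProduct,
      sub_zero, AddChar.map_zero_eq_one, Finset.sum_const, nsmul_eq_mul, mul_one, mul_zero,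
      Nat.cast_zero, add_zero] at this
    exact_mod_cast this
  have hμ0 : μ 0 = 0 := by
    refine eq_zero_of_character_sum_large ω ?_ μ (fun _ => sq_nonneg _) W B ?_ ((p : ℝ) ^ m)
      (by positivity) ?_ G hG ?_ 0 (by simp [W, hw0])
    · intro e d d'
      simp only [ω]
      rw [conj_stdAddChar, ← AddChar.map_add_eq_mul]
      congr 1
      simp only [Prod.fst_sub, Prod.snd_sub, sub_dotProduct, dotProduct_sub]
      ring
    · intro d hd d' hd'
      simp only [B, W, Finset.mem_filter, Finset.mem_univ, true_and] at hd hd' ⊢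
      have := quantumWeight_sub_le d.1 d.2 d'.1 d'.2
      rw [hd, hd'] at this
      exact Nat.lt_succ_of_le this
    · intro d hd
      obtain ⟨c, hc⟩ := hdet d.1 d.2 (by simpa [W] using hd)
      have := sum_stdAddChar_mul_norm_sq_trace v hv d.1 d.2 c
        (fun k l => hc _ (Subtype.coe_prop _) _ (Subtype.coe_prop _))
      have hK0' : (K : ℂ) ≠ 0 := by
        have := hK0.ne'
        exact_mod_cast this
      apply mul_left_cancel₀ hK0'
      -- The MacWilliams factor p^L / K becomes p^m with m = L - k.
      have hpow : (p : ℂ) ^ L = K * (p : ℂ) ^ m := by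
        rw [← hkm, pow_add]
        congr 1
        exact_mod_cast hdim.symm
      refine this.trans ?_
      rw [hpow, mul_assoc, Complex.ofReal_mul]
      simp [μ]
    · intro e he
      rw [hcard]
      exact hbound _ (by simpa [W] using he) (quantumWeight_le _ _)
  have : μ 0 = K ^ 2 := by
    have h1 : ∀ k, inner ℂ (v k) (v k) = (1 : ℂ) := fun k => by
      rw [orthonormal_iff_ite.1 hv k k, if_pos rfl]
    simp only [μ, Prod.fst_zero, Prod.snd_zero, pauli_zero]
    simp_rw [h1]
    simp
  rw [this] at hμ0
  exact hK0.ne' (by simpa using hμ0)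

end QuantumBound

/-! ### Stabilizer codes as joint fixed spaces -/

section FixedCode

variable {p : ℕ} [Fact p.Prime] {L : ℕ}

/-- For a ≠ 0 the shift fixes no basis vector, so the diagonal vanishes. For a = 0 the diagonal
entries are the values of the character b. -/
lemma trace_pauli (a b : Fin L → ZMod p) :
    LinearMap.trace ℂ (QState p L) (pauli a b) =
      if (a, b) = (0 : (Fin L → ZMod p) × (Fin L → ZMod p)) then (p : ℂ) ^ L else 0 := by
  rw [LinearMap.trace_eq_sum_inner _ (EuclideanSpace.basisFun (Fin L → ZMod p) ℂ)]
  have h : ∀ x, inner ℂ (EuclideanSpace.basisFun (Fin L → ZMod p) ℂ x)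
      (pauli a b (EuclideanSpace.basisFun (Fin L → ZMod p) ℂ x)) =
      ZMod.stdAddChar (N := p) (b ⬝ᵥ x) * if a = 0 then 1 else 0 := by
    intro x
    rw [EuclideanSpace.basisFun_inner, pauli_apply, EuclideanSpace.basisFun_apply,
      PiLp.single_apply]
    congr 1
    simp
  simp_rw [h, ← Finset.sum_mul, sum_stdAddChar_dotProduct, Prod.mk_eq_zero]
  by_cases h1 : a = 0 <;> by_cases h2 : b = 0 <;> simp [h1, h2]

/-- The joint fixed space of the error operators labelled by `S`. -/
def fixedCode (S : Submodule (ZMod p) ((Fin L → ZMod p) × (Fin L → ZMod p))) :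
    Submodule ℂ (QState p L) where
  carrier := {φ | ∀ w ∈ S, pauli w.1 w.2 φ = φ}
  add_mem' := by
    intro φ ψ hφ hψ w hw
    rw [map_add, hφ w hw, hψ w hw]
  zero_mem' := fun w _ => map_zero _
  smul_mem' := by
    intro c φ hφ w hw
    rw [map_smul, hφ w hw]

variable {S : Submodule (ZMod p) ((Fin L → ZMod p) × (Fin L → ZMod p))}

open Classical in
/-- The projector onto `fixedCode S`. -/
noncomputable def fixedProjector (S : Submodule (ZMod p) ((Fin L → ZMod p) × (Fin L → ZMod p))) :
    QState p L →ₗ[ℂ] QState p L :=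
  ((Fintype.card S : ℂ)⁻¹) • ∑ w : S, pauli w.1.1 w.1.2

/-- The hypothesis is stronger than symplectic isotropy: it removes the composition phase itself.
The operators of S therefore form a genuine representation, and its fixed space can be used without
choosing phases. -/
lemma pauli_add_of_orthogonal (hS : ∀ w ∈ S, ∀ w' ∈ S, w.1 ⬝ᵥ w'.2 = 0)
    {w w' : (Fin L → ZMod p) × (Fin L → ZMod p)} (hw : w ∈ S) (hw' : w' ∈ S) (φ : QState p L) :
    pauli w.1 w.2 (pauli w'.1 w'.2 φ) = pauli (w + w').1 (w + w').2 φ := by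
  rw [pauli_pauli, dotProduct_comm, hS w hw w' hw', neg_zero, AddChar.map_zero_eq_one, one_smul]
  rfl

lemma isProj_fixedProjector (hS : ∀ w ∈ S, ∀ w' ∈ S, w.1 ⬝ᵥ w'.2 = 0) :
    LinearMap.IsProj (fixedCode S) (fixedProjector S) := by
  classical
  constructor
  · intro φ w hw
    rw [fixedProjector, LinearMap.smul_apply, map_smul, LinearMap.sum_apply, map_sum]
    congr 1
    rw [← Equiv.sum_comp (Equiv.addLeft (⟨w, hw⟩ : S)) (fun w' : S => pauli w'.1.1 w'.1.2 φ)]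
    exact Finset.sum_congr rfl fun w' _ => pauli_add_of_orthogonal hS hw w'.2 φ
  · intro φ hφ
    rw [fixedProjector, LinearMap.smul_apply, LinearMap.sum_apply,
      Finset.sum_congr rfl fun w _ => hφ w.1 w.2, Finset.sum_const, Finset.card_univ,
      ← Nat.cast_smul_eq_nsmul ℂ, smul_smul, inv_mul_cancel₀, one_smul]
    exact_mod_cast Fintype.card_ne_zero

/-- The rank of the averaging projector is its trace, and only the identity of S has nonzero trace.
-/
lemma finrank_fixedCode_mul (hS : ∀ w ∈ S, ∀ w' ∈ S, w.1 ⬝ᵥ w'.2 = 0) :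
    Module.finrank ℂ (fixedCode S) * Nat.card S = p ^ L := by
  classical
  have h := (isProj_fixedProjector hS).trace
  rw [fixedProjector, map_smul, map_sum] at h
  simp_rw [trace_pauli] at h
  rw [Finset.sum_eq_single (0 : S)] at h
  · simp only [Submodule.coe_zero, Prod.fst_zero, Prod.snd_zero, Prod.mk_zero_zero, if_true,
      smul_eq_mul] at h
    have hc : (Fintype.card S : ℂ) ≠ 0 := by exact_mod_cast Fintype.card_ne_zero
    rw [Nat.card_eq_fintype_card]
    have : ((Module.finrank ℂ (fixedCode S) * Fintype.card S : ℕ) : ℂ) = ((p ^ L : ℕ) : ℂ) := by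
      push_cast
      rw [← h]
      field_simp
    exact_mod_cast this
  · intro w _ hw
    rw [if_neg]
    intro h0
    exact hw (Subtype.ext h0)
  · simp

/-- An error that does not commute with some stabilizer element maps the code to its orthogonal
complement. -/
lemma inner_pauli_eq_zero_of_not_commute {a b : Fin L → ZMod p}
    (h : ∃ w ∈ S, w.1 ⬝ᵥ b - a ⬝ᵥ w.2 ≠ 0) {φ ψ : QState p L} (hφ : φ ∈ fixedCode S)
    (hψ : ψ ∈ fixedCode S) : inner ℂ φ (pauli a b ψ) = 0 := by
  obtain ⟨w, hw, hne⟩ := h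
  have h1 : inner ℂ φ (pauli a b ψ) =
      ZMod.stdAddChar (N := p) (w.1 ⬝ᵥ b - a ⬝ᵥ w.2) * inner ℂ φ (pauli a b ψ) := by
    conv_lhs =>
      rw [← hψ w hw, pauli_comm, inner_smul_right]
    conv_rhs => rw [← inner_pauli_pauli w.1 w.2 φ, hφ w hw]
  have h2 : ZMod.stdAddChar (N := p) (w.1 ⬝ᵥ b - a ⬝ᵥ w.2) ≠ 1 := by
    rwa [Ne, stdAddChar_eq_one_iff]
  by_contra h0
  exact h2 (mul_right_cancel₀ h0 (by rw [one_mul]; exact h1.symm))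

/-- An error outside the stabilizer that commutes with it is undetectable. -/
lemma not_detects_of_commute (hS : ∀ w ∈ S, ∀ w' ∈ S, w.1 ⬝ᵥ w'.2 = 0) {a b : Fin L → ZMod p}
    (h : ∀ w ∈ S, w.1 ⬝ᵥ b - a ⬝ᵥ w.2 = 0) (hab : (a, b) ∉ S) :
    ¬ Detects (fixedCode S) (pauli a b) := by
  classical
  rintro ⟨c, hc⟩
  have hmem : ∀ ψ ∈ fixedCode S, pauli a b ψ ∈ fixedCode S := by
    intro ψ hψ w hw
    have : a ⬝ᵥ w.2 - w.1 ⬝ᵥ b = 0 := by rw [← neg_sub, h w hw, neg_zero]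
    rw [pauli_comm, this, AddChar.map_zero_eq_one, one_smul, hψ w hw]
  have hscal : ∀ ψ ∈ fixedCode S, pauli a b ψ = c • ψ := by
    intro ψ hψ
    have h1 : pauli a b ψ - c • ψ ∈ fixedCode S :=
      sub_mem (hmem ψ hψ) ((fixedCode S).smul_mem c hψ)
    have h2 := hc _ h1 ψ hψ
    rw [← sub_eq_zero, ← inner_self_eq_zero (𝕜 := ℂ)]
    nth_rewrite 2 [sub_eq_add_neg]
    rw [inner_add_right, h2, inner_neg_right, inner_smul_right]
    ring
  -- The error preserves the code, so detectability makes it the scalar c there. Its trace against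
  -- the projector is c times the dimension, and also 0 because (a, b) + w never vanishes for w in
  -- S. Then c = 0, contradicting unitarity on a nonzero code.
  have hP : pauli a b ∘ₗ fixedProjector S = c • fixedProjector S := by
    ext1 φ
    exact hscal _ ((isProj_fixedProjector hS).map_mem φ)
  have htr : LinearMap.trace ℂ (QState p L) (pauli a b ∘ₗ fixedProjector S) = 0 := by
    rw [fixedProjector, LinearMap.comp_smul, map_smul]
    have : pauli a b ∘ₗ (∑ w : S, pauli w.1.1 w.1.2) =
        ∑ w : S, ZMod.stdAddChar (N := p) (-(w.1.2 ⬝ᵥ a)) • pauli (a + w.1.1) (b + w.1.2) := by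
      ext1 φ
      simp only [LinearMap.comp_apply, LinearMap.sum_apply, map_sum, pauli_pauli,
        LinearMap.smul_apply]
    rw [this, map_sum, Finset.sum_eq_zero, smul_zero]
    intro w _
    rw [map_smul, trace_pauli, if_neg, smul_zero]
    intro h0
    apply hab
    have : (a, b) = -w.1 := by
      rw [eq_neg_iff_add_eq_zero]
      exact h0
    rw [this]
    exact neg_mem w.2
  have hrank : (Module.finrank ℂ (fixedCode S) : ℂ) ≠ 0 := by
    have h1 := finrank_fixedCode_mul hS
    have h2 : p ^ L ≠ 0 := pow_ne_zero _ (Fact.out : p.Prime).ne_zero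
    rw [← h1] at h2
    exact_mod_cast (left_ne_zero_of_mul h2)
  rw [hP, map_smul, (isProj_fixedProjector hS).trace, smul_eq_mul] at htr
  have hc0 : c = 0 := (mul_eq_zero.1 htr).resolve_right hrank
  apply hrank
  have : fixedCode S = ⊥ := by
    rw [eq_bot_iff]
    intro ψ hψ
    have h1 := inner_pauli_pauli a b ψ ψ
    rw [hscal ψ hψ, hc0, zero_smul, inner_zero_left] at h1
    exact (inner_self_eq_zero (𝕜 := ℂ)).1 h1.symm
  rw [this]
  simp

end FixedCode

/-! ### Dual codes and syndromes -/

section Duality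

variable {p : ℕ} [Fact p.Prime] {ι : Type} [Fintype ι] {L : ℕ}

lemma mem_dualCode_definingSetCode {x : Fin L → ι → ZMod p} {y : Fin L → ZMod p} :
    y ∈ dualCode (definingSetCode x) ↔ Matrix.vecMul y (Matrix.of x) = 0 := by
  have h : y ∈ dualCode (definingSetCode x) ↔ ∀ α, y ⬝ᵥ Matrix.mulVec (Matrix.of x) α = 0 := by
    constructor
    · exact fun h α => h _ ⟨α, rfl⟩
    · rintro h _ ⟨α, rfl⟩
      exact h α
  simp_rw [h, Matrix.dotProduct_mulVec]
  constructor
  · exact dotProduct_eq_zero _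
  · rintro h α
    rw [h, zero_dotProduct]

/-- The double dual of a code is the code. -/
lemma exists_mulVec_of_orthogonal {x : Fin L → ι → ZMod p} {s : Fin L → ZMod p}
    (h : ∀ u, Matrix.vecMul u (Matrix.of x) = 0 → s ⬝ᵥ u = 0) :
    ∃ α, s = Matrix.mulVec (Matrix.of x) α := by
  let ℓ : ι → (Fin L → ZMod p) →ₗ[ZMod p] ZMod p := fun j =>
    (LinearMap.proj j).comp (Matrix.vecMulLinear (Matrix.of x))
  let K : (Fin L → ZMod p) →ₗ[ZMod p] ZMod p := dotProductBilin (ZMod p) (ZMod p) s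
  -- A functional that vanishes on the common kernel of finitely many functionals is a linear
  -- combination of them. The coefficients are the message α.
  have hK : K ∈ Submodule.span (ZMod p) (Set.range ℓ) := by
    refine mem_span_of_iInf_ker_le_ker fun u hu => ?_
    simp only [Submodule.mem_iInf, LinearMap.mem_ker] at hu ⊢
    exact h u (funext hu)
  obtain ⟨α, hα⟩ := (Submodule.mem_span_range_iff_exists_fun (ZMod p)).1 hK
  refine ⟨α, funext fun i => ?_⟩
  have := LinearMap.congr_fun hα (Pi.single i 1)
  simp only [ℓ, K, LinearMap.sum_apply, LinearMap.smul_apply, LinearMap.comp_apply,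
    Matrix.vecMulLinear_apply, Matrix.single_one_vecMul, LinearMap.proj_apply, smul_eq_mul,
    dotProductBilin_apply_apply, dotProduct_single, mul_one] at this
  rw [← this, Matrix.mulVec, dotProduct]
  exact Finset.sum_congr rfl fun j _ => mul_comm _ _

end Duality

/-! ### Steane's enlargement along a plane that misses the points -/

section Steane

/-- The point set `x` is the column set of a self-orthogonal ternary code of full rank with
pairwise independent columns, none of which lies in the plane spanned by `v₁` and `v₂`. -/
structure IsSteaneConfiguration {ι : Type} [Fintype ι] {L : ℕ} (x : Fin L → ι → ZMod 3)
    (v₁ v₂ : ι → ZMod 3) : Prop where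
  spanning : ∀ α, (∀ i, x i ⬝ᵥ α = 0) → α = 0
  pairwise : ∀ (i j : Fin L) (c : ZMod 3), i ≠ j → x i ≠ c • x j
  orthogonal : ∀ α β, ∑ i, x i ⬝ᵥ α * x i ⬝ᵥ β = 0
  avoids : ∀ (i : Fin L) (s t : ZMod 3), x i ≠ s • v₁ + t • v₂
  independent : ∃ w₁ w₂ : ι → ZMod 3,
    w₁ ⬝ᵥ v₁ = 1 ∧ w₁ ⬝ᵥ v₂ = 0 ∧ w₂ ⬝ᵥ v₁ = 0 ∧ w₂ ⬝ᵥ v₂ = 1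

namespace IsSteaneConfiguration

variable {ι : Type} [Fintype ι] {L : ℕ} {x : Fin L → ι → ZMod 3} {v₁ v₂ : ι → ZMod 3}

lemma eq_zero_of_smul_eq (h : IsSteaneConfiguration x v₁ v₂) {i : Fin L} {c s t : ZMod 3}
    (hc : c • x i = s • v₁ + t • v₂) : c = 0 := by
  by_contra h0
  apply h.avoids i (c⁻¹ * s) (c⁻¹ * t)
  rw [mul_smul, mul_smul, ← smul_add, ← hc, smul_smul, inv_mul_cancel₀ h0, one_smul]

lemma coeff_eq_zero (h : IsSteaneConfiguration x v₁ v₂) {s t : ZMod 3}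
    (hst : s • v₁ + t • v₂ = 0) : s = 0 ∧ t = 0 := by
  obtain ⟨w₁, w₂, h11, h12, h21, h22⟩ := h.independent
  constructor
  · have := congrArg (w₁ ⬝ᵥ ·) hst
    simpa [dotProduct_add, dotProduct_smul, h11, h12] using this
  · have := congrArg (w₂ ⬝ᵥ ·) hst
    simpa [dotProduct_add, dotProduct_smul, h21, h22] using this

lemma smul_add_smul_eq_zero (h : IsSteaneConfiguration x v₁ v₂) {i j : Fin L} (hij : i ≠ j)
    {a b : ZMod 3} (hab : a • x i + b • x j = 0) : a = 0 ∧ b = 0 := by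
  have ha : a = 0 := by
    by_contra h0
    apply h.pairwise i j (-(a⁻¹ * b)) hij
    rw [neg_smul, mul_smul, ← smul_neg, ← eq_neg_of_add_eq_zero_left hab, smul_smul,
      inv_mul_cancel₀ h0, one_smul]
  rw [ha, zero_smul, zero_add] at hab
  exact ⟨ha, h.eq_zero_of_smul_eq (s := 0) (t := 0) (by simpa using hab)⟩

/-- Two points do not span vectors `s v₁ + t v₂` and `s v₂ - t v₁` simultaneously. -/
lemma two_point (h : IsSteaneConfiguration x v₁ v₂) {i j : Fin L} (hij : i ≠ j)
    {a b a' b' s t : ZMod 3} (h1 : a • x i + b • x j = s • v₁ + t • v₂)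
    (h2 : a' • x i + b' • x j = s • v₂ - t • v₁) : (a = 0 ∧ b = 0) ∧ a' = 0 ∧ b' = 0 := by
  -- Anisotropy of u² + v² over 𝔽₃.
  have hsq : ∀ u v : ZMod 3, u ^ 2 + v ^ 2 = 0 → u = 0 ∧ v = 0 := by decide
  -- Eliminating x_j leaves a multiple of x_i in the plane, so both sides vanish. The resulting
  -- linear system in (s, t) has determinant b'² + b² up to sign, so either s = t = 0 or b = b' = 0.
  have hD : (b' * a - b * a') • x i =
      (b' * s + b * t) • v₁ + (b' * t - b * s) • v₂ := by
    have : (b' * a - b * a') • x i =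
        b' • (a • x i + b • x j) - b • (a' • x i + b' • x j) := by module
    rw [this, h1, h2]; module
  have hD0 := h.eq_zero_of_smul_eq hD
  rw [hD0, zero_smul] at hD
  obtain ⟨e1, e2⟩ := h.coeff_eq_zero hD.symm
  by_cases hst : s = 0 ∧ t = 0
  · rw [hst.1, hst.2, zero_smul, zero_smul] at h1 h2
    exact ⟨h.smul_add_smul_eq_zero hij (by simpa using h1),
      h.smul_add_smul_eq_zero hij (by simpa using h2)⟩
  · have hb : b' = 0 ∧ b = 0 := by
      by_contra hbb
      have hne : b' ^ 2 + b ^ 2 ≠ 0 := fun h0 => hbb (hsq _ _ h0)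
      apply hst
      constructor
      · exact (mul_eq_zero.1 (show (b' ^ 2 + b ^ 2) * s = 0 by
          linear_combination b' * e1 - b * e2)).resolve_left hne
      · exact (mul_eq_zero.1 (show (b' ^ 2 + b ^ 2) * t = 0 by
          linear_combination b * e1 + b' * e2)).resolve_left hne
    rw [hb.2, zero_smul, add_zero] at h1
    rw [hb.1, zero_smul, add_zero] at h2
    refine ⟨⟨h.eq_zero_of_smul_eq h1, hb.2⟩, h.eq_zero_of_smul_eq (i := i) (s := -t) (t := s) ?_, hb.1⟩
    rw [h2]; module

/-- The pairs of the enlarged code have quantum weight at least three. -/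
lemma eq_zero_of_quantumWeight_lt (h : IsSteaneConfiguration x v₁ v₂) {y y' : Fin L → ZMod 3}
    {s t : ZMod 3} (h1 : Matrix.vecMul y (Matrix.of x) = s • v₁ + t • v₂)
    (h2 : Matrix.vecMul y' (Matrix.of x) = s • v₂ - t • v₁) (hw : quantumWeight y y' < 3) :
    y = 0 ∧ y' = 0 := by
  have hsupp : ∀ T : Finset (Fin L), (Finset.univ.filter fun i => y i ≠ 0 ∨ y' i ≠ 0) = T →
      (∀ i ∈ T, y i = 0 ∧ y' i = 0) → y = 0 ∧ y' = 0 := by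
    intro T hT hz
    have : ∀ i, y i = 0 ∧ y' i = 0 := by
      intro i
      by_contra hi
      refine hi (hz i ?_)
      rw [← hT, Finset.mem_filter]
      exact ⟨Finset.mem_univ i, by tauto⟩
    exact ⟨funext fun i => (this i).1, funext fun i => (this i).2⟩
  have hsum : ∀ T : Finset (Fin L), (Finset.univ.filter fun i => y i ≠ 0 ∨ y' i ≠ 0) = T →
      Matrix.vecMul y (Matrix.of x) = ∑ i ∈ T, y i • x i ∧
      Matrix.vecMul y' (Matrix.of x) = ∑ i ∈ T, y' i • x i := by
    intro T hT
    have hz : ∀ i, i ∉ T → y i = 0 ∧ y' i = 0 := by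
      intro i hi
      rw [← hT, Finset.mem_filter] at hi
      by_contra h0
      exact hi ⟨Finset.mem_univ i, by tauto⟩
    rw [Matrix.vecMul_eq_sum, Matrix.vecMul_eq_sum]
    constructor
    · symm
      refine Finset.sum_subset (Finset.subset_univ T) fun i _ hi => ?_
      rw [(hz i hi).1, zero_smul]
    · symm
      refine Finset.sum_subset (Finset.subset_univ T) fun i _ hi => ?_
      rw [(hz i hi).2, zero_smul]
  unfold quantumWeight at hw
  generalize hT : (Finset.univ.filter fun i => y i ≠ 0 ∨ y' i ≠ 0) = T at hw
  obtain ⟨s1, s2⟩ := hsum T hT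
  rw [h1] at s1
  rw [h2] at s2
  refine hsupp T hT ?_
  have hcases : T.card = 0 ∨ T.card = 1 ∨ T.card = 2 := by omega
  rcases hcases with hc | hc | hc
  · rw [Finset.card_eq_zero.1 hc]; simp
  · obtain ⟨i, rfl⟩ := Finset.card_eq_one.1 hc
    rw [Finset.sum_singleton] at s1 s2
    intro j hj
    rw [Finset.mem_singleton.1 hj]
    refine ⟨h.eq_zero_of_smul_eq s1.symm, h.eq_zero_of_smul_eq (i := i) (s := -t) (t := s) ?_⟩
    rw [← s2]; module
  · obtain ⟨i, j, hij, rfl⟩ := Finset.card_eq_two.1 hc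
    rw [Finset.sum_pair hij] at s1 s2
    obtain ⟨⟨z1, z2⟩, z3, z4⟩ := h.two_point hij s1.symm s2.symm
    intro k hk
    rcases Finset.mem_insert.1 hk with rfl | hk
    · exact ⟨z1, z3⟩
    · rw [Finset.mem_singleton.1 hk]
      exact ⟨z2, z4⟩

/-- Subtracting multiples of the dual vectors w₁, w₂ moves any α into the annihilator of the plane,
so q is determined by its pairings with w₁ and w₂. -/
lemma exists_eq_of_orthogonal (h : IsSteaneConfiguration x v₁ v₂) {q : ι → ZMod 3}
    (hq : ∀ α, α ⬝ᵥ v₁ = 0 → α ⬝ᵥ v₂ = 0 → α ⬝ᵥ q = 0) : ∃ s t : ZMod 3, q = s • v₁ + t • v₂ := by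
  obtain ⟨w₁, w₂, h11, h12, h21, h22⟩ := h.independent
  refine ⟨w₁ ⬝ᵥ q, w₂ ⬝ᵥ q, ?_⟩
  rw [← sub_eq_zero]
  refine dotProduct_eq_zero _ fun α => ?_
  have := hq (α - (α ⬝ᵥ v₁) • w₁ - (α ⬝ᵥ v₂) • w₂)
    (by simp [sub_dotProduct, smul_dotProduct, h11, h21])
    (by simp [sub_dotProduct, smul_dotProduct, h12, h22])
  simp only [sub_dotProduct, smul_dotProduct, smul_eq_mul] at this
  simp only [sub_dotProduct, add_dotProduct, smul_dotProduct, smul_eq_mul]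
  rw [dotProduct_comm q, dotProduct_comm v₁, dotProduct_comm v₂]
  linear_combination this

/-- The annihilator of the message pairs is the graph of the rotation J on the plane. Correcting α
alone already makes an arbitrary pair (α, β) satisfy both equations. -/
lemma exists_eq_of_orthogonal_prod (h : IsSteaneConfiguration x v₁ v₂) {q q' : ι → ZMod 3}
    (hq : ∀ α β, α ⬝ᵥ v₂ - β ⬝ᵥ v₁ = 0 → α ⬝ᵥ v₁ + β ⬝ᵥ v₂ = 0 → α ⬝ᵥ q' - β ⬝ᵥ q = 0) :
    ∃ s t : ZMod 3, q = s • v₁ + t • v₂ ∧ q' = s • v₂ - t • v₁ := by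
  obtain ⟨w₁, w₂, h11, h12, h21, h22⟩ := h.independent
  have key : ∀ α β, α ⬝ᵥ q' - β ⬝ᵥ q = (α ⬝ᵥ v₁ + β ⬝ᵥ v₂) * (w₁ ⬝ᵥ q') +
      (α ⬝ᵥ v₂ - β ⬝ᵥ v₁) * (w₂ ⬝ᵥ q') := by
    intro α β
    have := hq (α - (α ⬝ᵥ v₁ + β ⬝ᵥ v₂) • w₁ - (α ⬝ᵥ v₂ - β ⬝ᵥ v₁) • w₂) β
      (by simp [sub_dotProduct, smul_dotProduct, h12, h22])
      (by simp [sub_dotProduct, smul_dotProduct, h11, h21])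
    simp only [sub_dotProduct, smul_dotProduct, smul_eq_mul] at this
    linear_combination this
  refine ⟨w₂ ⬝ᵥ q', -(w₁ ⬝ᵥ q'), ?_, ?_⟩
  · rw [← sub_eq_zero]
    refine dotProduct_eq_zero _ fun β => ?_
    have := key 0 β
    simp only [zero_dotProduct] at this
    simp only [sub_dotProduct, add_dotProduct, smul_dotProduct, smul_eq_mul]
    rw [dotProduct_comm q, dotProduct_comm v₁, dotProduct_comm v₂]
    linear_combination -this
  · rw [← sub_eq_zero]
    refine dotProduct_eq_zero _ fun α => ?_
    have := key α 0
    simp only [zero_dotProduct] at this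
    simp only [sub_dotProduct, smul_dotProduct, smul_eq_mul]
    rw [dotProduct_comm q', dotProduct_comm v₁, dotProduct_comm v₂]
    linear_combination this

end IsSteaneConfiguration

variable {ι : Type} [Fintype ι] {L : ℕ}

/-- The pairs `(α, β)` with `α ⬝ v₂ = β ⬝ v₁` and `α ⬝ v₁ = -β ⬝ v₂`. -/
def messagePairs (v₁ v₂ : ι → ZMod 3) : Submodule (ZMod 3) ((ι → ZMod 3) × (ι → ZMod 3)) where
  carrier := {w | w.1 ⬝ᵥ v₂ - w.2 ⬝ᵥ v₁ = 0 ∧ w.1 ⬝ᵥ v₁ + w.2 ⬝ᵥ v₂ = 0}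
  add_mem' := by
    rintro a b ⟨h1, h2⟩ ⟨h3, h4⟩
    simp only [Set.mem_ofPred_eq, Prod.fst_add, Prod.snd_add, add_dotProduct]
    exact ⟨by linear_combination h1 + h3, by linear_combination h2 + h4⟩
  zero_mem' := by simp
  smul_mem' := by
    rintro c a ⟨h1, h2⟩
    simp only [Set.mem_ofPred_eq, Prod.smul_fst, Prod.smul_snd, smul_dotProduct, smul_eq_mul]
    exact ⟨by linear_combination c * h1, by linear_combination c * h2⟩

/-- The stabilizer of the enlarged code: the pairs of codewords of the messages in
`messagePairs v₁ v₂`. -/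
def steaneStabilizer (x : Fin L → ι → ZMod 3) (v₁ v₂ : ι → ZMod 3) :
    Submodule (ZMod 3) ((Fin L → ZMod 3) × (Fin L → ZMod 3)) :=
  (messagePairs v₁ v₂).map
    ((Matrix.mulVecLin (Matrix.of x)).prodMap (Matrix.mulVecLin (Matrix.of x)))

lemma mem_steaneStabilizer {x : Fin L → ι → ZMod 3} {v₁ v₂ : ι → ZMod 3}
    {w : (Fin L → ZMod 3) × (Fin L → ZMod 3)} :
    w ∈ steaneStabilizer x v₁ v₂ ↔ ∃ α β, α ⬝ᵥ v₂ - β ⬝ᵥ v₁ = 0 ∧ α ⬝ᵥ v₁ + β ⬝ᵥ v₂ = 0 ∧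
      w = (Matrix.mulVec (Matrix.of x) α, Matrix.mulVec (Matrix.of x) β) := by
  constructor
  · rintro ⟨⟨α, β⟩, ⟨h1, h2⟩, rfl⟩
    exact ⟨α, β, h1, h2, rfl⟩
  · rintro ⟨α, β, h1, h2, rfl⟩
    exact ⟨⟨α, β⟩, ⟨h1, h2⟩, rfl⟩

namespace IsSteaneConfiguration

variable {x : Fin L → ι → ZMod 3} {v₁ v₂ : ι → ZMod 3}

lemma mulVec_injective (h : IsSteaneConfiguration x v₁ v₂) :
    Function.Injective (Matrix.mulVecLin (Matrix.of x)) := by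
  rw [← LinearMap.ker_eq_bot, LinearMap.ker_eq_bot']
  intro α hα
  exact h.spanning α fun i => congrFun hα i

lemma mulVec_dotProduct_mulVec (h : IsSteaneConfiguration x v₁ v₂) (α β : ι → ZMod 3) :
    Matrix.mulVec (Matrix.of x) α ⬝ᵥ Matrix.mulVec (Matrix.of x) β = 0 :=
  h.orthogonal α β

lemma vecMul_mulVec (h : IsSteaneConfiguration x v₁ v₂) (α : ι → ZMod 3) :
    Matrix.vecMul (Matrix.mulVec (Matrix.of x) α) (Matrix.of x) = 0 := by
  refine dotProduct_eq_zero _ fun β => ?_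
  rw [← Matrix.dotProduct_mulVec, h.mulVec_dotProduct_mulVec]

/-- The message pairs are cut out by two independent equations, and encoding is injective because
the points span. -/
lemma card_steaneStabilizer_mul (h : IsSteaneConfiguration x v₁ v₂) :
    Nat.card (steaneStabilizer x v₁ v₂) * 3 ^ 2 = 3 ^ (2 * Fintype.card ι) := by
  have h1 : Nat.card (steaneStabilizer x v₁ v₂) = Nat.card (messagePairs v₁ v₂) := by
    refine (Nat.card_congr (Submodule.equivMapOfInjective _ ?_ (messagePairs v₁ v₂)).toEquiv).symm
    exact Function.Injective.prodMap h.mulVec_injective h.mulVec_injective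
  let ℓ : ((ι → ZMod 3) × (ι → ZMod 3)) →ₗ[ZMod 3] ZMod 3 × ZMod 3 :=
    { toFun := fun w => (w.1 ⬝ᵥ v₂ - w.2 ⬝ᵥ v₁, w.1 ⬝ᵥ v₁ + w.2 ⬝ᵥ v₂)
      map_add' := by
        intro a b
        simp only [Prod.fst_add, Prod.snd_add, add_dotProduct, Prod.mk_add_mk, Prod.mk.injEq]
        constructor <;> ring
      map_smul' := by
        intro c a
        simp only [Prod.smul_fst, Prod.smul_snd, smul_dotProduct, smul_eq_mul, RingHom.id_apply,
          Prod.smul_mk, Prod.mk.injEq]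
        constructor <;> ring }
  have hker : LinearMap.ker ℓ = messagePairs v₁ v₂ := by
    ext w
    exact Prod.mk_eq_zero
  have hsurj : Function.Surjective ℓ := by
    rintro ⟨s, t⟩
    obtain ⟨w₁, w₂, h11, h12, h21, h22⟩ := h.independent
    refine ⟨(s • w₂ + t • w₁, 0), ?_⟩
    simp [ℓ, add_dotProduct, smul_dotProduct, h11, h12, h21, h22]
  have h2 := LinearMap.finrank_range_add_finrank_ker ℓ
  rw [LinearMap.range_eq_top.2 hsurj, finrank_top, hker] at h2
  simp only [Module.finrank_prod, Module.finrank_self, Module.finrank_fintype_fun_eq_card] at h2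
  rw [h1, Module.natCard_eq_pow_finrank (K := ZMod 3), Nat.card_zmod, ← pow_add]
  congr 1
  omega

lemma fst_dotProduct_snd (h : IsSteaneConfiguration x v₁ v₂) :
    ∀ w ∈ steaneStabilizer x v₁ v₂, ∀ w' ∈ steaneStabilizer x v₁ v₂, w.1 ⬝ᵥ w'.2 = 0 := by
  intro w hw w' hw'
  obtain ⟨α, -, -, -, rfl⟩ := mem_steaneStabilizer.1 hw
  obtain ⟨-, β, -, -, rfl⟩ := mem_steaneStabilizer.1 hw'
  exact h.mulVec_dotProduct_mulVec α β

/-- A pair that commutes with the stabilizer belongs to the enlarged code. -/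
lemma exists_vecMul_eq (h : IsSteaneConfiguration x v₁ v₂) {a b : Fin L → ZMod 3}
    (hab : ∀ w ∈ steaneStabilizer x v₁ v₂, w.1 ⬝ᵥ b - a ⬝ᵥ w.2 = 0) :
    ∃ s t : ZMod 3, Matrix.vecMul a (Matrix.of x) = s • v₁ + t • v₂ ∧
      Matrix.vecMul b (Matrix.of x) = s • v₂ - t • v₁ := by
  refine h.exists_eq_of_orthogonal_prod fun α β h1 h2 => ?_
  have := hab _ (mem_steaneStabilizer.2 ⟨α, β, h1, h2, rfl⟩)
  rw [dotProduct_comm _ b, Matrix.dotProduct_mulVec, Matrix.dotProduct_mulVec] at this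
  rwa [dotProduct_comm α, dotProduct_comm β]

lemma commute_of_vecMul_eq {a b : Fin L → ZMod 3} {s t : ZMod 3}
    (ha : Matrix.vecMul a (Matrix.of x) = s • v₁ + t • v₂)
    (hb : Matrix.vecMul b (Matrix.of x) = s • v₂ - t • v₁) :
    ∀ w ∈ steaneStabilizer x v₁ v₂, w.1 ⬝ᵥ b - a ⬝ᵥ w.2 = 0 := by
  intro w hw
  obtain ⟨α, β, h1, h2, rfl⟩ := mem_steaneStabilizer.1 hw
  rw [dotProduct_comm _ b, Matrix.dotProduct_mulVec, Matrix.dotProduct_mulVec, ha, hb]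
  simp only [sub_dotProduct, add_dotProduct, smul_dotProduct, smul_eq_mul]
  rw [dotProduct_comm v₁, dotProduct_comm v₂, dotProduct_comm v₁, dotProduct_comm v₂]
  linear_combination s * h1 - t * h2

/-- An error commuting with the stabilizer lies in the enlarged code, which has no nonzero pair of
weight below 3. Every error of weight 1 or 2 thus fails to commute with some stabilizer element and
maps the code to its orthogonal complement. -/
lemma isPure_fixedCode (h : IsSteaneConfiguration x v₁ v₂) :
    IsPure 3 (fixedCode (steaneStabilizer x v₁ v₂)) := by
  intro a b hw1 hw3 φ hφ ψ hψ
  refine inner_pauli_eq_zero_of_not_commute ?_ hφ hψ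
  by_contra hcon
  push Not at hcon
  obtain ⟨s, t, hs, ht⟩ := h.exists_vecMul_eq hcon
  obtain ⟨rfl, rfl⟩ := h.eq_zero_of_quantumWeight_lt hs ht hw3
  simp [quantumWeight] at hw1

lemma isQuantumCode_fixedCode (h : IsSteaneConfiguration x v₁ v₂) {k : ℕ} (hk1 : 1 ≤ k)
    (hk : k + 2 * Fintype.card ι = L + 2) :
    IsQuantumCode k 3 (fixedCode (steaneStabilizer x v₁ v₂)) := by
  refine ⟨hk1, ?_, fun a b hw => ?_⟩
  · have h1 := finrank_fixedCode_mul h.fst_dotProduct_snd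
    have h2 := h.card_steaneStabilizer_mul
    have h3 : Module.finrank ℂ (fixedCode (steaneStabilizer x v₁ v₂)) *
        3 ^ (2 * Fintype.card ι) = 3 ^ k * 3 ^ (2 * Fintype.card ι) := by
      rw [← pow_add, hk, pow_add, ← h1, ← h2, mul_assoc]
    exact Nat.eq_of_mul_eq_mul_right (by positivity) h3
  · rcases Nat.eq_zero_or_pos (quantumWeight a b) with h0 | h0
    · have hz : a = 0 ∧ b = 0 := by
        unfold quantumWeight at h0
        rw [Finset.card_eq_zero, Finset.filter_eq_empty_iff] at h0
        constructor <;> funext i <;> have := h0 (Finset.mem_univ i) <;> simp at this <;>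
          simp [this]
      refine ⟨1, fun φ _ ψ _ => ?_⟩
      rw [hz.1, hz.2, pauli_zero, one_mul]
    · exact ⟨0, fun φ hφ ψ hψ => by rw [zero_mul, h.isPure_fixedCode a b h0 hw φ hφ ψ hψ]⟩

/-- The pair (e₁, e₂) has syndromes (v₁, v₂), so it commutes with the stabilizer. It is not in the
stabilizer, whose components have zero syndrome by self-orthogonality. Its weight cannot be below 3,
so it is exactly 3. -/
lemma qDistLE_fixedCode (h : IsSteaneConfiguration x v₁ v₂) {e₁ e₂ : Fin L → ZMod 3}
    (he₁ : Matrix.vecMul e₁ (Matrix.of x) = v₁) (he₂ : Matrix.vecMul e₂ (Matrix.of x) = v₂)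
    (hw : quantumWeight e₁ e₂ ≤ 3) : QDistLE 3 (fixedCode (steaneStabilizer x v₁ v₂)) := by
  have ha : Matrix.vecMul e₁ (Matrix.of x) = (1 : ZMod 3) • v₁ + (0 : ZMod 3) • v₂ := by
    rw [he₁]; module
  have hb : Matrix.vecMul e₂ (Matrix.of x) = (1 : ZMod 3) • v₂ - (0 : ZMod 3) • v₁ := by
    rw [he₂]; module
  have hne : v₁ ≠ 0 := by
    rintro rfl
    obtain ⟨w₁, w₂, h11, -⟩ := h.independent
    simp at h11
  refine ⟨e₁, e₂, le_antisymm hw ?_, not_detects_of_commute h.fst_dotProduct_snd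
    (commute_of_vecMul_eq ha hb) ?_⟩
  · by_contra hlt
    obtain ⟨rfl, -⟩ := h.eq_zero_of_quantumWeight_lt ha hb (not_le.1 hlt)
    exact hne (by rw [← he₁, Matrix.zero_vecMul])
  · intro hmem
    obtain ⟨α, β, -, -, heq⟩ := mem_steaneStabilizer.1 hmem
    apply hne
    rw [← he₁, (Prod.mk.inj heq).1, h.vecMul_mulVec]

/-- The fixed space of `steaneStabilizer x v₁ v₂` arises by Steane's enlargement. -/
lemma isSteaneEnlargement_fixedCode (h : IsSteaneConfiguration x v₁ v₂)
    {e₁ e₂ : Fin L → ZMod 3} (he₁ : Matrix.vecMul e₁ (Matrix.of x) = v₁)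
    (he₂ : Matrix.vecMul e₂ (Matrix.of x) = v₂) :
    ∃ C ≤ definingSetCode x, IsSteaneEnlargement (dualCode (definingSetCode x)) (dualCode C)
      (fixedCode (steaneStabilizer x v₁ v₂)) := by
  -- The messages orthogonal to the plane: the dual of C then consists of the words whose syndrome
  -- lies in the plane.
  let C : Submodule (ZMod 3) (Fin L → ZMod 3) :=
    { carrier := {c | ∃ α : ι → ZMod 3, α ⬝ᵥ v₁ = 0 ∧ α ⬝ᵥ v₂ = 0 ∧
        c = Matrix.mulVec (Matrix.of x) α}
      add_mem' := by
        rintro _ _ ⟨α, h1, h2, rfl⟩ ⟨β, h3, h4, rfl⟩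
        exact ⟨α + β, by rw [add_dotProduct, h1, h3, add_zero],
          by rw [add_dotProduct, h2, h4, add_zero], (Matrix.mulVec_add _ _ _).symm⟩
      zero_mem' := ⟨0, zero_dotProduct _, zero_dotProduct _, (Matrix.mulVec_zero _).symm⟩
      smul_mem' := by
        rintro c _ ⟨α, h1, h2, rfl⟩
        exact ⟨c • α, by rw [smul_dotProduct, h1, smul_zero],
          by rw [smul_dotProduct, h2, smul_zero], (Matrix.mulVec_smul _ _ _).symm⟩ }
  have hCle : C ≤ definingSetCode x := by
    rintro _ ⟨α, -, -, rfl⟩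
    exact ⟨α, rfl⟩
  have hself : definingSetCode x ≤ dualCode (definingSetCode x) := by
    rintro _ ⟨α, rfl⟩
    exact mem_dualCode_definingSetCode.2 (h.vecMul_mulVec α)
  -- E is the range of ℓ, and the syndrome map sends it isomorphically onto the plane.
  let ℓ : (ZMod 3 × ZMod 3) →ₗ[ZMod 3] (Fin L → ZMod 3) :=
    (LinearMap.toSpanSingleton (ZMod 3) _ e₁).coprod (LinearMap.toSpanSingleton (ZMod 3) _ e₂)
  have hℓ : ∀ s t, ℓ (s, t) = s • e₁ + t • e₂ := by
    intro s t
    simp [ℓ, LinearMap.toSpanSingleton_apply]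
  have hvec : ∀ s t, Matrix.vecMul (ℓ (s, t)) (Matrix.of x) = s • v₁ + t • v₂ := by
    intro s t
    rw [hℓ, Matrix.add_vecMul, Matrix.smul_vecMul, Matrix.smul_vecMul, he₁, he₂]
  have hinj0 : ∀ q, Matrix.vecMul (ℓ q) (Matrix.of x) = 0 → q = 0 := by
    rintro ⟨s, t⟩ hq
    rw [hvec] at hq
    obtain ⟨rfl, rfl⟩ := h.coeff_eq_zero hq
    rfl
  have hinj : Function.Injective ℓ := by
    rw [← LinearMap.ker_eq_bot, LinearMap.ker_eq_bot']
    intro q hq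
    exact hinj0 q (by rw [hq, Matrix.zero_vecMul])
  let e := LinearEquiv.ofInjective ℓ hinj
  -- J² = -1, so an eigenvalue in 𝔽₃ would be a square root of -1.
  let J : (ZMod 3 × ZMod 3) →ₗ[ZMod 3] (ZMod 3 × ZMod 3) :=
    (-LinearMap.snd (ZMod 3) (ZMod 3) (ZMod 3)).prod (LinearMap.fst (ZMod 3) (ZMod 3) (ZMod 3))
  have hJ : ∀ s t, J (s, t) = (-t, s) := fun s t => rfl
  let A : LinearMap.range ℓ →ₗ[ZMod 3] LinearMap.range ℓ :=
    e.toLinearMap ∘ₗ J ∘ₗ e.symm.toLinearMap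
  have hA : ∀ q, A (e q) = e (J q) := by
    intro q
    simp [A]
  have hdisj : Disjoint (dualCode (definingSetCode x)) (LinearMap.range ℓ) := by
    rw [Submodule.disjoint_def]
    rintro _ h1 ⟨q, rfl⟩
    rw [hinj0 q (mem_dualCode_definingSetCode.1 h1), map_zero]
  have hsup : dualCode (definingSetCode x) ⊔ LinearMap.range ℓ = dualCode C := by
    apply le_antisymm
    · refine sup_le (fun y hy c hc => hy c (hCle hc)) ?_
      rintro _ ⟨⟨s, t⟩, rfl⟩ _ ⟨α, h1, h2, rfl⟩
      rw [Matrix.dotProduct_mulVec, hvec, dotProduct_comm, dotProduct_add, dotProduct_smul,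
        dotProduct_smul, h1, h2, smul_zero, smul_zero, add_zero]
    · intro y hy
      obtain ⟨s, t, hst⟩ := h.exists_eq_of_orthogonal
        (q := Matrix.vecMul y (Matrix.of x)) (fun α h1 h2 => by
          rw [dotProduct_comm, ← Matrix.dotProduct_mulVec]
          exact hy _ ⟨α, h1, h2, rfl⟩)
      rw [Submodule.mem_sup]
      refine ⟨y - ℓ (s, t), ?_, ℓ (s, t), ⟨_, rfl⟩, sub_add_cancel _ _⟩
      rw [mem_dualCode_definingSetCode, Matrix.sub_vecMul, hst, hvec, sub_self]
  refine ⟨C, hCle, fun y hy c hc => hy c (hself hc), fun y hy c hc => hy c (hCle hc), ?_,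
    LinearMap.range ℓ, A, hdisj, hsup, ?_, ?_⟩
  · have h1 := Submodule.finrank_sup_add_finrank_inf_eq (dualCode (definingSetCode x))
      (LinearMap.range ℓ)
    rw [hsup, hdisj.eq_bot, finrank_bot, ← e.finrank_eq, Module.finrank_prod,
      Module.finrank_self] at h1
    omega
  · intro r y hy
    obtain ⟨⟨s, t⟩, rfl⟩ := e.surjective y
    rw [hA, ← map_smul] at hy
    have h1 := e.injective hy
    rw [hJ] at h1
    have h2 := congrArg Prod.fst h1
    have h3 := congrArg Prod.snd h1
    simp only [Prod.smul_mk, smul_eq_mul] at h2 h3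
    have hdec : ∀ r s t : ZMod 3, -t = r * s → s = r * t → s = 0 ∧ t = 0 := by decide
    obtain ⟨rfl, rfl⟩ := hdec r s t h2 h3
    exact map_zero e
  · have hS : symplecticDual {w : (Fin L → ZMod 3) × (Fin L → ZMod 3) |
        ∃ u ∈ dualCode (definingSetCode x), ∃ v ∈ dualCode (definingSetCode x),
          ∃ y : LinearMap.range ℓ,
            w = (u + (y : Fin L → ZMod 3), v + (A y : Fin L → ZMod 3))} =
        (steaneStabilizer x v₁ v₂ : Set ((Fin L → ZMod 3) × (Fin L → ZMod 3))) := by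
      ext w
      constructor
      · intro hw
        -- Testing against (0, u) and (u, 0) with u in the dual code shows that both components are
        -- codewords. Testing against the lifted plane then gives the two message equations.
        obtain ⟨α, hα⟩ := exists_mulVec_of_orthogonal (x := x) (s := w.1) (fun u hu => by
          have := hw (0, u) ⟨0, zero_mem _, u, mem_dualCode_definingSetCode.2 hu, 0, by simp⟩
          simpa using this)
        obtain ⟨β, hβ⟩ := exists_mulVec_of_orthogonal (x := x) (s := w.2) (fun u hu => by
          have := hw (u, 0) ⟨u, mem_dualCode_definingSetCode.2 hu, 0, zero_mem _, 0, by simp⟩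
          rw [dotProduct_comm]
          simpa using this)
        have hq : ∀ s t : ZMod 3, α ⬝ᵥ ((-t) • v₁ + s • v₂) - β ⬝ᵥ (s • v₁ + t • v₂) = 0 := by
          intro s t
          have := hw (ℓ (s, t), ℓ (-t, s)) ⟨0, zero_mem _, 0, zero_mem _, e (s, t), by
            rw [hA, hJ, zero_add, zero_add]; rfl⟩
          rw [hα, hβ, dotProduct_comm, Matrix.dotProduct_mulVec, Matrix.dotProduct_mulVec, hvec,
            hvec] at this
          rwa [dotProduct_comm α, dotProduct_comm β]
        refine mem_steaneStabilizer.2 ⟨α, β, ?_, ?_, Prod.ext hα hβ⟩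
        · simpa using hq 1 0
        · have := hq 0 1
          simp only [neg_smul, one_smul, zero_smul, add_zero, zero_add, dotProduct_neg] at this
          linear_combination -this
      · intro hw m hm
        obtain ⟨u, hu, v, hv, y, rfl⟩ := hm
        obtain ⟨⟨s, t⟩, rfl⟩ := e.surjective y
        refine commute_of_vecMul_eq (s := s) (t := t) ?_ ?_ w hw
        · rw [Matrix.add_vecMul, mem_dualCode_definingSetCode.1 hu, zero_add]
          exact hvec s t
        · rw [Matrix.add_vecMul, mem_dualCode_definingSetCode.1 hv, zero_add, hA, hJ]
          refine (hvec (-t) s).trans ?_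
          module
    rw [hS]
    refine ⟨?_, fun _ => 1, fun φ => ?_⟩
    · intro hbot
      have h1 := finrank_fixedCode_mul h.fst_dotProduct_snd
      rw [hbot, finrank_bot, zero_mul] at h1
      exact pow_ne_zero L three_ne_zero h1.symm
    · simp only [one_smul]
      exact Iff.rfl

end IsSteaneConfiguration

end Steane

/-! ### Representatives of the zeros up to sign -/

section Transversal

variable {ι : Type} {L : ℕ} {f : (ι → ZMod 3) → ZMod 3}
  {x : Fin L → ι → ZMod 3}

lemma units_zmod_three (u : (ZMod 3)ˣ) : u = 1 ∨ u = -1 := by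
  revert u; decide

lemma IsZeroTransversal.exists_smul_eq (h : IsZeroTransversal f x) {v : ι → ZMod 3} (hv : v ≠ 0)
    (hfv : f v = 0) : ∃ (i : Fin L) (c : ZMod 3), v = c • x i := by
  obtain ⟨q, hq, -⟩ := h.2 v hv hfv
  exact ⟨q.1, q.2, hq⟩

lemma IsZeroTransversal.pairwise (h : IsZeroTransversal f x) (i j : Fin L) (c : ZMod 3)
    (hij : i ≠ j) : x i ≠ c • x j := by
  intro heq
  have hc : c ≠ 0 := by
    rintro rfl
    exact (h.1 i).1 (by rw [heq, zero_smul])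
  obtain ⟨q, -, hq⟩ := h.2 (x i) (h.1 i).1 (h.1 i).2
  have h1 := hq (i, 1) (by simp)
  have h2 := hq (j, Units.mk0 c hc) (by simpa using heq)
  exact hij (Prod.mk.inj (h1.trans h2.symm)).1

variable [Fintype ι] [DecidableEq ι]

/-- Summing an even function over the nonzero zeros of an even function. -/
lemma IsZeroTransversal.sum_zeros {R : Type*} [CommRing R] (h : IsZeroTransversal f x)
    (hf : ∀ v, f (-v) = f v) (F : (ι → ZMod 3) → R) (hF : ∀ v, F (-v) = F v) :
    ∑ v with v ≠ 0 ∧ f v = 0, F v = 2 * ∑ i, F (x i) := by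
  have hu : ∀ (u : (ZMod 3)ˣ) (G : (ι → ZMod 3) → R), (∀ v, G (-v) = G v) → ∀ v,
      G ((u : ZMod 3) • v) = G v := by
    intro u G hG v
    rcases units_zmod_three u with rfl | rfl
    · simp
    · simpa using hG v
  have h1 : ∑ v with v ≠ 0 ∧ f v = 0, F v =
      ∑ q : Fin L × (ZMod 3)ˣ, F ((q.2 : ZMod 3) • x q.1) := by
    symm
    refine Finset.sum_bij (fun q _ => (q.2 : ZMod 3) • x q.1) ?_ ?_ ?_ (fun _ _ => rfl)
    · rintro ⟨i, u⟩ -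
      simp only [Finset.mem_filter, Finset.mem_univ, true_and]
      refine ⟨?_, ?_⟩
      · intro h0
        rw [smul_eq_zero] at h0
        exact h0.elim u.ne_zero (h.1 i).1
      · rcases units_zmod_three u with rfl | rfl
        · simpa using (h.1 i).2
        · simpa [hf] using (h.1 i).2
    · intro q _ q' _ hqq
      have hz : (q.2 : ZMod 3) • x q.1 ≠ 0 ∧ f ((q.2 : ZMod 3) • x q.1) = 0 := by
        refine ⟨?_, ?_⟩
        · intro h0
          rw [smul_eq_zero] at h0
          exact h0.elim q.2.ne_zero (h.1 _).1
        · rcases units_zmod_three q.2 with hq | hq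
          · simpa [hq] using (h.1 q.1).2
          · simpa [hq, hf] using (h.1 q.1).2
      exact (h.2 _ hz.1 hz.2).unique rfl hqq
    · intro v hv
      simp only [Finset.mem_filter, Finset.mem_univ, true_and] at hv
      obtain ⟨q, hq, -⟩ := h.2 v hv.1 hv.2
      exact ⟨q, Finset.mem_univ _, hq.symm⟩
  have hcard : Fintype.card (ZMod 3)ˣ = 2 := by decide
  rw [h1, Fintype.sum_prod_type, Finset.mul_sum]
  refine Finset.sum_congr rfl fun i _ => ?_
  simp_rw [fun u => hu u F hF]
  rw [Finset.sum_const, Finset.card_univ, hcard, two_smul, two_mul]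

lemma IsZeroTransversal.two_mul_add_one (h : IsZeroTransversal f x)
    (hf : ∀ v, f (-v) = f v) (hf0 : f 0 = 0) :
    2 * L + 1 = (Finset.univ.filter fun v => f v = 0).card := by
  have h1 := h.sum_zeros hf (fun _ => (1 : ℤ)) fun _ => rfl
  have h2 : (Finset.univ.filter fun v => f v = 0) =
      insert 0 (Finset.univ.filter fun v => v ≠ 0 ∧ f v = 0) := by
    ext v
    by_cases hv : v = 0 <;> simp [hv, hf0]
  rw [h2, Finset.card_insert_of_notMem (by simp)]
  simp only [Finset.sum_const, nsmul_eq_mul, mul_one, Finset.card_univ, Fintype.card_fin] at h1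
  have h3 : (Finset.univ.filter fun v => v ≠ 0 ∧ f v = 0).card = 2 * L := by exact_mod_cast h1
  rw [h3]

/-- From each pair ±v take the vector that comes first in an arbitrary enumeration. The two differ
since 2 is invertible. -/
lemma exists_isZeroTransversal (hf : ∀ v, f (-v) = f v) :
    ∃ (L : ℕ) (x : Fin L → ι → ZMod 3), IsZeroTransversal f x := by
  let e := Fintype.equivFin (ι → ZMod 3)
  let D := Finset.univ.filter fun v => (v ≠ 0 ∧ f v = 0) ∧ e v < e (-v)
  have hD : ∀ v, v ∈ D ↔ (v ≠ 0 ∧ f v = 0) ∧ e v < e (-v) := fun v => by simp [D]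
  have hnot : ∀ v, v ∈ D → -v ∉ D := by
    intro v hv hv'
    have h1 := ((hD _).1 hv).2
    have h2 := ((hD _).1 hv').2
    rw [neg_neg] at h2
    exact lt_asymm h1 h2
  have hor : ∀ v, v ≠ 0 → f v = 0 → v ∈ D ∨ -v ∈ D := by
    intro v hv hfv
    have hne : v ≠ -v := by
      intro h0
      apply hv
      funext i
      have : ∀ a : ZMod 3, a = -a → a = 0 := by decide
      exact this _ (congrFun h0 i)
    rcases lt_or_gt_of_ne (fun h0 => hne (e.injective h0)) with h1 | h1
    · exact Or.inl ((hD v).2 ⟨⟨hv, hfv⟩, h1⟩)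
    · exact Or.inr ((hD _).2 ⟨⟨neg_ne_zero.2 hv, by rw [hf, hfv]⟩, by rwa [neg_neg]⟩)
  let x : Fin D.card → ι → ZMod 3 := fun i => (D.equivFin.symm i : ι → ZMod 3)
  have hxD : ∀ i, x i ∈ D := fun i => (D.equivFin.symm i).2
  have hinj : Function.Injective x := fun i j hij =>
    D.equivFin.symm.injective (Subtype.ext hij)
  have hx : ∀ v ∈ D, ∃ i, x i = v := fun v hv =>
    ⟨D.equivFin ⟨v, hv⟩, by simp [x]⟩
  refine ⟨D.card, x, fun i => ((hD _).1 (hxD i)).1, fun v hv hfv => ?_⟩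
  rcases hor v hv hfv with h | h
  · obtain ⟨i, hi⟩ := hx v h
    refine ⟨(i, 1), by simp [hi], ?_⟩
    rintro ⟨j, u⟩ hj
    rcases units_zmod_three u with rfl | rfl
    · have : x j = x i := by rw [hi, hj]; simp
      rw [hinj this]
    · exfalso
      apply hnot v h
      rw [hj]
      simpa using hxD j
  · obtain ⟨i, hi⟩ := hx _ h
    refine ⟨(i, -1), by simp [hi], ?_⟩
    rintro ⟨j, u⟩ hj
    rcases units_zmod_three u with rfl | rfl
    · exfalso
      apply hnot v _ h
      rw [hj]
      simpa using hxD j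
    · have : x j = x i := by rw [hi, hj]; simp
      rw [hinj this]

/-- The points of a ternary quadric in dimension at least four form a self-orthogonal code. -/
lemma IsZeroTransversal.sum_dotProduct_mul (h : IsZeroTransversal f x) (hf : ∀ v, f (-v) = f v)
    (P : MvPolynomial ι (ZMod 3)) (hP : P.totalDegree ≤ 2)
    (hPf : ∀ v, MvPolynomial.eval v P = f v) (hι : 4 ≤ Fintype.card ι) (α β : ι → ZMod 3) :
    ∑ i, x i ⬝ᵥ α * x i ⬝ᵥ β = 0 := by
  let lin : (ι → ZMod 3) → MvPolynomial ι (ZMod 3) := fun α =>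
    ∑ j, MvPolynomial.C (α j) * MvPolynomial.X j
  have hlin : ∀ α, (lin α).totalDegree ≤ 1 := by
    intro α
    refine MvPolynomial.totalDegree_finsetSum_le fun j _ => ?_
    refine (MvPolynomial.totalDegree_mul _ _).trans ?_
    rw [MvPolynomial.totalDegree_C, MvPolynomial.totalDegree_X]
  have hev : ∀ α v, MvPolynomial.eval v (lin α) = v ⬝ᵥ α := by
    intro α v
    simp [lin, dotProduct, mul_comm]
  -- Over 𝔽₃ the polynomial 1 - P² is the indicator of the zeros. The total degree is at most 4 + 2
  -- = 6, below 2n since n ≥ 4.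
  have hdeg : ((1 - P ^ 2) * (lin α * lin β)).totalDegree < (Fintype.card (ZMod 3) - 1) *
      Fintype.card ι := by
    have h1 : (1 - P ^ 2).totalDegree ≤ 4 := by
      refine (MvPolynomial.totalDegree_sub _ _).trans (max_le ?_ ?_)
      · rw [MvPolynomial.totalDegree_one]; exact Nat.zero_le _
      · exact (MvPolynomial.totalDegree_pow _ _).trans (by omega)
    have h2 := MvPolynomial.totalDegree_mul (1 - P ^ 2) (lin α * lin β)
    have h3 := MvPolynomial.totalDegree_mul (lin α) (lin β)
    have h4 := hlin α
    have h5 := hlin β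
    rw [ZMod.card]
    omega
  have hsum := MvPolynomial.sum_eval_eq_zero _ hdeg
  have hind : ∀ t : ZMod 3, 1 - t ^ 2 = if t = 0 then 1 else 0 := by decide
  simp only [map_mul, map_sub, map_pow, map_one, hPf, hev, hind, ite_mul, one_mul, zero_mul,
    ← Finset.sum_filter] at hsum
  have h2 := h.sum_zeros hf (fun v => v ⬝ᵥ α * v ⬝ᵥ β) (fun v => by simp)
  have h3 : ∑ v with v ≠ 0 ∧ f v = 0, v ⬝ᵥ α * v ⬝ᵥ β = ∑ v with f v = 0, v ⬝ᵥ α * v ⬝ᵥ β := by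
    refine Finset.sum_subset (fun v hv => ?_) fun v hv hv' => ?_
    · simp only [Finset.mem_filter] at hv ⊢
      exact ⟨hv.1, hv.2.2⟩
    · simp only [Finset.mem_filter, Finset.mem_univ, true_and] at hv hv'
      have : v = 0 := by
        by_contra h0
        exact hv' ⟨h0, hv⟩
      simp [this]
  rw [← h3, h2] at hsum
  exact (mul_eq_zero.1 hsum).resolve_left (by decide)

end Transversal

/-! ### Walsh transform of g(x) + y · z -/

section WalshSums

variable {p : ℕ} [Fact p.Prime]

lemma sum_sum_elim {A B α R : Type*} [Fintype A] [DecidableEq A] [Fintype B] [DecidableEq B]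
    [Fintype α] [AddCommMonoid R] (F : (A ⊕ B → α) → R) :
    ∑ v, F v = ∑ a : A → α, ∑ b : B → α, F (Sum.elim a b) := by
  rw [← Fintype.sum_prod_type' (f := fun a b => F (Sum.elim a b)),
    ← Equiv.sum_comp (Equiv.sumArrowEquivProdArrow A B α).symm]
  rfl

/-- The Walsh transform of `g (x) + y ⬝ z` on the coordinates `(x, y, z, u)`. -/
lemma walsh_gmmFun {n₁ n₂ : ℕ} (s : ℕ) (g : (Fin n₁ → ZMod p) → ZMod p)
    (α : GMMIndex n₁ n₂ s → ZMod p) :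
    walsh (gmmFun (n₂ := n₂) s fun _ => g) α =
      walsh g (fun i => α (Sum.inl i)) *
        ((p : ℂ) ^ n₂ * ZMod.stdAddChar (N := p)
          (-((fun i => α (Sum.inr (Sum.inr (Sum.inl i)))) ⬝ᵥ fun i => α (Sum.inr (Sum.inl i)))) *
        if (fun i => α (Sum.inr (Sum.inr (Sum.inr i)))) = 0 then (p : ℂ) ^ s else 0) := by
  set a := fun i => α (Sum.inl i) with ha
  set b := fun i => α (Sum.inr (Sum.inl i)) with hb
  set c := fun i => α (Sum.inr (Sum.inr (Sum.inl i))) with hc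
  set d := fun i => α (Sum.inr (Sum.inr (Sum.inr i))) with hd
  unfold walsh
  have key : ∀ (x : Fin n₁ → ZMod p) (y z : Fin n₂ → ZMod p) (u : Fin s → ZMod p),
      ZMod.stdAddChar (N := p) (gmmFun s (fun _ => g) (Sum.elim x (Sum.elim y (Sum.elim z u))) -
        α ⬝ᵥ Sum.elim x (Sum.elim y (Sum.elim z u))) =
      ZMod.stdAddChar (N := p) (g x - a ⬝ᵥ x) * (ZMod.stdAddChar (N := p) ((z - b) ⬝ᵥ y) *
        (ZMod.stdAddChar (N := p) (-(c ⬝ᵥ z)) * ZMod.stdAddChar (N := p) ((-d) ⬝ᵥ u))) := by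
    intro x y z u
    simp_rw [← AddChar.map_add_eq_mul]
    congr 1
    have h1 : α ⬝ᵥ Sum.elim x (Sum.elim y (Sum.elim z u)) =
        a ⬝ᵥ x + (b ⬝ᵥ y + (c ⬝ᵥ z + d ⬝ᵥ u)) := by
      simp only [dotProduct, Fintype.sum_sum_type]
      rfl
    have h2 : gmmFun s (fun _ => g) (Sum.elim x (Sum.elim y (Sum.elim z u))) =
        g x + z ⬝ᵥ y := by
      rw [dotProduct_comm]; rfl
    rw [h1, h2, sub_dotProduct, neg_dotProduct]
    ring
  rw [sum_sum_elim, Finset.sum_mul]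
  refine Finset.sum_congr rfl fun x _ => ?_
  rw [sum_sum_elim]
  simp_rw [sum_sum_elim (A := Fin n₂) (B := Fin s), key]
  have h3 : ∑ y : Fin n₂ → ZMod p, ∑ z : Fin n₂ → ZMod p, ∑ u : Fin s → ZMod p,
      ZMod.stdAddChar (N := p) ((z - b) ⬝ᵥ y) *
        (ZMod.stdAddChar (N := p) (-(c ⬝ᵥ z)) * ZMod.stdAddChar (N := p) ((-d) ⬝ᵥ u)) =
      (p : ℂ) ^ n₂ * ZMod.stdAddChar (N := p) (-(c ⬝ᵥ b)) *
        if d = 0 then (p : ℂ) ^ s else 0 := by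
    -- The sum over y vanishes unless z = b.
    rw [Finset.sum_comm, Finset.sum_eq_single b]
    · simp_rw [← Finset.mul_sum, ← Finset.sum_mul, sum_stdAddChar_dotProduct, neg_eq_zero,
        sub_self, if_true, Fintype.card_fin, mul_assoc]
    · intro z _ hz
      simp_rw [← Finset.mul_sum, ← Finset.sum_mul, sum_stdAddChar_dotProduct,
        if_neg (sub_ne_zero.2 hz), zero_mul]
    · simp
  rw [← h3]
  simp_rw [Finset.mul_sum]

end WalshSums

/-! ### Gauss sums over 𝔽₃ and diagonal forms -/

section TernaryGaussSums

lemma stdAddChar_three_one :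
    ZMod.stdAddChar (N := 3) 1 = -1 / 2 + (Real.sqrt 3 : ℂ) / 2 * Complex.I := by
  have h := ZMod.stdAddChar_coe (N := 3) 1
  rw [Int.cast_one] at h
  rw [h]
  have h1 : 2 * (Real.pi : ℂ) * Complex.I * ((1 : ℤ) : ℂ) / ((3 : ℕ) : ℂ) =
      ((Real.pi - Real.pi / 3 : ℝ) : ℂ) * Complex.I := by
    push_cast; ring
  rw [h1, Complex.exp_mul_I, ← Complex.ofReal_cos, ← Complex.ofReal_sin, Real.cos_pi_sub,
    Real.sin_pi_sub, Real.cos_pi_div_three, Real.sin_pi_div_three]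
  push_cast
  ring

lemma stdAddChar_three_two :
    ZMod.stdAddChar (N := 3) 2 = -1 / 2 - (Real.sqrt 3 : ℂ) / 2 * Complex.I := by
  have h : (2 : ZMod 3) = -1 := by decide
  rw [h, ← conj_stdAddChar, stdAddChar_three_one]
  simp only [map_add, map_mul, map_div₀, map_neg, map_one, map_ofNat, Complex.conj_ofReal,
    Complex.conj_I]
  ring

/-- The quadratic Gauss sum `∑ a, ξ ^ (d a ^ 2)` over `ZMod 3` for `d ≠ 0`. -/
noncomputable def ternaryGaussSum (d : ZMod 3) : ℂ :=
  (if d = 1 then 1 else -1) * (Real.sqrt 3 * Complex.I)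

lemma sum_stdAddChar_quadratic {d : ZMod 3} (hd : d ≠ 0) (c : ZMod 3) :
    ∑ a : ZMod 3, ZMod.stdAddChar (N := 3) (d * a ^ 2 - c * a) =
      ternaryGaussSum d * ZMod.stdAddChar (N := 3) (-(d * c ^ 2)) := by
  -- Completing the square: 2 = -1 and d² = 1, so the shift -c / (2d) equals d c.
  have h1 : ∀ d c a : ZMod 3, d ≠ 0 → d * a ^ 2 - c * a = d * (a + d * c) ^ 2 + -(d * c ^ 2) := by
    decide
  have h2 : ∑ a : ZMod 3, ZMod.stdAddChar (N := 3) (d * a ^ 2) = ternaryGaussSum d := by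
    have h3 : ∑ a : ZMod 3, ZMod.stdAddChar (N := 3) (d * a ^ 2) =
        ZMod.stdAddChar (N := 3) (d * 0 ^ 2) + ZMod.stdAddChar (N := 3) (d * 1 ^ 2) +
          ZMod.stdAddChar (N := 3) (d * 2 ^ 2) :=
      Fin.sum_univ_three fun a : ZMod 3 => ZMod.stdAddChar (N := 3) (d * a ^ 2)
    have h4 : (2 : ZMod 3) ^ 2 = 1 := by decide
    have h5 : ∀ d : ZMod 3, d ≠ 0 → d = 1 ∨ d = 2 := by decide
    have h6 : (2 : ZMod 3) ≠ 1 := by decide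
    rw [h3, h4, one_pow, mul_one, zero_pow two_ne_zero, mul_zero, AddChar.map_zero_eq_one,
      ternaryGaussSum]
    rcases h5 d hd with rfl | rfl
    · rw [stdAddChar_three_one, if_pos rfl]; ring
    · rw [stdAddChar_three_two, if_neg h6]; ring
  simp_rw [h1 d c _ hd, AddChar.map_add_eq_mul, ← Finset.sum_mul]
  rw [← h2, ← Equiv.sum_comp (Equiv.addRight (d * c))
    fun a : ZMod 3 => ZMod.stdAddChar (N := 3) (d * a ^ 2)]
  rfl

/-- The diagonal quadratic form with coefficients `d`. -/
def diagonalForm {m : ℕ} (d : Fin m → ZMod 3) (x : Fin m → ZMod 3) : ZMod 3 :=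
  ∑ i, d i * x i ^ 2

lemma walsh_diagonalForm {m : ℕ} {d : Fin m → ZMod 3} (hd : ∀ i, d i ≠ 0)
    (α : Fin m → ZMod 3) :
    walsh (diagonalForm d) α = (∏ i, ternaryGaussSum (d i)) *
      ZMod.stdAddChar (N := 3) (-∑ i, d i * α i ^ 2) := by
  have h := sum_stdAddChar_sum (p := 3) (fun (i : Fin m) (a : ZMod 3) => d i * a ^ 2 - α i * a)
  simp_rw [sum_stdAddChar_quadratic (hd _), Finset.prod_mul_distrib, ← stdAddChar_sum,
    Finset.sum_neg_distrib, Finset.sum_sub_distrib] at h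
  exact h

lemma norm_ternaryGaussSum (d : ZMod 3) : ‖ternaryGaussSum d‖ = Real.sqrt 3 := by
  unfold ternaryGaussSum
  rw [norm_mul, norm_mul, Complex.norm_I, mul_one, Complex.norm_real, Real.norm_eq_abs,
    abs_of_nonneg (Real.sqrt_nonneg 3)]
  split_ifs <;> simp

lemma norm_stdAddChar {p : ℕ} [Fact p.Prime] (a : ZMod p) :
    ‖ZMod.stdAddChar (N := p) a‖ = 1 := AddChar.norm_apply _ _

lemma sqrt_three_pow (m : ℕ) : Real.sqrt (3 ^ m) = Real.sqrt 3 ^ m := by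
  rw [← Real.sqrt_sq (pow_nonneg (Real.sqrt_nonneg 3) m), ← pow_mul, mul_comm, pow_mul,
    Real.sq_sqrt (by norm_num)]

lemma norm_walsh_diagonalForm {m : ℕ} {d : Fin m → ZMod 3} (hd : ∀ i, d i ≠ 0)
    (α : Fin m → ZMod 3) : ‖walsh (diagonalForm d) α‖ = Real.sqrt 3 ^ m := by
  rw [walsh_diagonalForm hd, norm_mul, norm_stdAddChar, mul_one, norm_prod]
  simp_rw [norm_ternaryGaussSum]
  simp

lemma isBent_diagonalForm {m : ℕ} {d : Fin m → ZMod 3} (hd : ∀ i, d i ≠ 0) :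
    IsBent (diagonalForm d) := by
  refine ⟨Nat.zero_le _, fun α => Or.inr ?_⟩
  rw [norm_walsh_diagonalForm hd, Fintype.card_fin, add_zero, Nat.cast_ofNat, sqrt_three_pow]

lemma isWeaklyRegular_diagonalForm {m : ℕ} {d : Fin m → ZMod 3} (hd : ∀ i, d i ≠ 0) (ε : ℂ)
    (hε : ε = 1 ∨ ε = -1 ∨ ε = Complex.I ∨ ε = -Complex.I)
    (hprod : ∏ i, ternaryGaussSum (d i) = ε * (Real.sqrt 3 : ℂ) ^ m) :
    IsWeaklyRegular (diagonalForm d) 0 := by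
  refine ⟨ε, fun α => -∑ i, d i * α i ^ 2, hε, fun α _ => ?_⟩
  rw [walsh_diagonalForm hd, hprod, Fintype.card_fin, add_zero, Nat.cast_ofNat, sqrt_three_pow]
  push_cast
  rfl

/-- The constant family of a diagonal quadratic form is admissible. -/
lemma isAdmissibleFamily_diagonalForm {m n₂ : ℕ} {d : Fin m → ZMod 3} (hd : ∀ i, d i ≠ 0) (ε : ℂ)
    (hε : ε = 1 ∨ ε = -1 ∨ ε = Complex.I ∨ ε = -Complex.I)
    (hprod : ∏ i, ternaryGaussSum (d i) = ε * (Real.sqrt 3 : ℂ) ^ m) :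
    IsAdmissibleFamily (n₂ := n₂) fun _ => diagonalForm d := by
  refine fun _ => ⟨fun c x _ => ?_, isBent_diagonalForm hd,
    isWeaklyRegular_diagonalForm hd ε hε hprod, ?_, fun _ _ => rfl⟩
  · simp only [diagonalForm, Finset.mul_sum, Pi.smul_apply, smul_eq_mul]
    exact Finset.sum_congr rfl fun i _ => by ring
  · simp [diagonalForm]

variable {n₁ n₂ s : ℕ} {d : Fin n₁ → ZMod 3}

/-- The transform vanishes exactly when the u-frequency is nonzero. Otherwise its modulus is √3^n₁ ·
3^n₂ · 3^s, which is √3^(n + s). -/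
lemma isPlateaued_gmmFun_diagonalForm (n₂ s : ℕ) (hd : ∀ i, d i ≠ 0) :
    IsPlateaued (gmmFun (n₂ := n₂) s fun _ => diagonalForm d) s := by
  refine ⟨by simp; omega, fun α => ?_⟩
  rw [walsh_gmmFun, norm_mul, norm_walsh_diagonalForm hd, norm_mul, norm_mul, norm_stdAddChar]
  split_ifs
  · right
    have h3 : Real.sqrt 3 ^ 2 = 3 := Real.sq_sqrt (by norm_num)
    simp only [Fintype.card_sum, Fintype.card_fin, Nat.cast_ofNat, norm_pow, sqrt_three_pow,
      Complex.norm_ofNat, mul_one]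
    nth_rewrite 2 [← h3]
    nth_rewrite 3 [← h3]
    ring
  · left; simp

lemma walsh_zero_gmmFun_diagonalForm (n₂ s : ℕ) (hd : ∀ i, d i ≠ 0) :
    walsh (gmmFun (n₂ := n₂) s fun _ => diagonalForm d) 0 =
      (∏ i, ternaryGaussSum (d i)) * 3 ^ (n₂ + s) := by
  rw [walsh_gmmFun]
  have h0 : (fun i : Fin s => (0 : GMMIndex n₁ n₂ s → ZMod 3)
    (Sum.inr (Sum.inr (Sum.inr i)))) = 0 := rfl
  have h1 : (fun i : Fin n₁ => (0 : GMMIndex n₁ n₂ s → ZMod 3) (Sum.inl i)) = 0 := rfl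
  rw [h1, walsh_diagonalForm hd]
  simp only [Pi.zero_apply]
  simp [← Pi.zero_def, pow_add]

/-- The number of zeros of a ternary function from its Walsh transform at zero. -/
lemma three_mul_card_zeros {ι : Type} [Fintype ι] [DecidableEq ι] (f : (ι → ZMod 3) → ZMod 3) :
    3 * ((Finset.univ.filter fun v => f v = 0).card : ℂ) =
      3 ^ Fintype.card ι + walsh f 0 + (starRingEnd ℂ) (walsh f 0) := by
  -- The indicator of t = 0 is the average of ξ^(ct) over c ∈ 𝔽₃. The terms c = 1 and c = -1 are
  -- conjugate.
  have h1 : ∀ t : ZMod 3, 1 + ZMod.stdAddChar (N := 3) t +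
      (starRingEnd ℂ) (ZMod.stdAddChar (N := 3) t) = if t = 0 then 3 else 0 := by
    intro t
    have h5 : ∀ d : ZMod 3, d = 0 ∨ d = 1 ∨ d = 2 := by decide
    have h6 : (2 : ZMod 3) ≠ 0 := by decide
    have h7 : -(2 : ZMod 3) = 1 := by decide
    have h8 : -(1 : ZMod 3) = 2 := by decide
    rw [conj_stdAddChar]
    rcases h5 t with rfl | rfl | rfl
    · simp; norm_num
    · rw [h8, stdAddChar_three_one, stdAddChar_three_two, if_neg one_ne_zero]; ring
    · rw [h7, stdAddChar_three_one, stdAddChar_three_two, if_neg h6]; ring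
  have h2 : ∑ v : ι → ZMod 3, (1 + ZMod.stdAddChar (N := 3) (f v) +
      (starRingEnd ℂ) (ZMod.stdAddChar (N := 3) (f v))) =
      3 ^ Fintype.card ι + walsh f 0 + (starRingEnd ℂ) (walsh f 0) := by
    rw [Finset.sum_add_distrib, Finset.sum_add_distrib]
    simp [walsh]
  rw [← h2]
  simp_rw [h1]
  rw [← Finset.sum_filter, Finset.sum_const, nsmul_eq_mul, mul_comm]

end TernaryGaussSums

/-! ### The quadric and its anisotropic plane -/

section QuadricPoints

variable {n₁ n₂ s : ℕ}

/-- The standard basis vectors of the coordinates `x`, `y`, `z`. -/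
def quadricVector (s : ℕ) (j : Fin n₁) (i : Fin n₂) (a b c : ZMod 3) :
    GMMIndex n₁ n₂ s → ZMod 3 :=
  a • Pi.single (Sum.inl j) 1 + b • Pi.single (Sum.inr (Sum.inl i)) 1 +
    c • Pi.single (Sum.inr (Sum.inr (Sum.inl i))) 1

lemma gmmFun_quadricVector (d : Fin n₁ → ZMod 3) (j : Fin n₁) (i : Fin n₂) (a b c : ZMod 3) :
    gmmFun s (fun _ => diagonalForm d) (quadricVector s j i a b c) = d j * a ^ 2 + b * c := by
  simp [gmmFun, diagonalForm, quadricVector, Pi.single_apply, ite_pow]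

lemma gmmFun_neg (d : Fin n₁ → ZMod 3) (v : GMMIndex n₁ n₂ s → ZMod 3) :
    gmmFun s (fun _ => diagonalForm d) (-v) = gmmFun s (fun _ => diagonalForm d) v := by
  simp [gmmFun, diagonalForm]

lemma gmmFun_zero (d : Fin n₁ → ZMod 3) :
    gmmFun (n₂ := n₂) s (fun _ => diagonalForm d) 0 = 0 := by
  simp [gmmFun, diagonalForm]

/-- The polynomial of the quadratic form. -/
noncomputable def gmmPolynomial (n₂ s : ℕ) (d : Fin n₁ → ZMod 3) :
    MvPolynomial (GMMIndex n₁ n₂ s) (ZMod 3) :=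
  ∑ i, MvPolynomial.C (d i) * MvPolynomial.X (Sum.inl i) ^ 2 +
    ∑ i : Fin n₂, MvPolynomial.X (Sum.inr (Sum.inl i)) *
      MvPolynomial.X (Sum.inr (Sum.inr (Sum.inl i)))

lemma totalDegree_gmmPolynomial_le (d : Fin n₁ → ZMod 3) :
    (gmmPolynomial n₂ s d).totalDegree ≤ 2 := by
  refine (MvPolynomial.totalDegree_add _ _).trans (max_le ?_ ?_)
  · refine MvPolynomial.totalDegree_finsetSum_le fun i _ => ?_
    refine (MvPolynomial.totalDegree_mul _ _).trans ?_
    rw [MvPolynomial.totalDegree_C, MvPolynomial.totalDegree_X_pow]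
  · refine MvPolynomial.totalDegree_finsetSum_le fun i _ => ?_
    refine (MvPolynomial.totalDegree_mul _ _).trans ?_
    rw [MvPolynomial.totalDegree_X, MvPolynomial.totalDegree_X]

lemma eval_gmmPolynomial (d : Fin n₁ → ZMod 3) (v : GMMIndex n₁ n₂ s → ZMod 3) :
    MvPolynomial.eval v (gmmPolynomial n₂ s d) = gmmFun s (fun _ => diagonalForm d) v := by
  simp [gmmPolynomial, gmmFun, diagonalForm]

variable {L : ℕ} {x : Fin L → GMMIndex n₁ n₂ s → ZMod 3} {d : Fin n₁ → ZMod 3}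

/-- The points of the quadric together with an anisotropic plane form a configuration to which
Steane's enlargement applies. -/
lemma isSteaneConfiguration_quadric
    (h : IsZeroTransversal (gmmFun s fun _ => diagonalForm d) x)
    (hn : 4 ≤ n₁ + 2 * n₂ + s) (j : Fin n₁) (i : Fin n₂) (hj : d j = 1) :
    IsSteaneConfiguration x (quadricVector s j i 1 0 0) (quadricVector s j i 0 1 1) := by
  refine ⟨fun α hα => ?_, h.pairwise, ?_, ?_, ?_⟩
  · have hzero : ∀ v, gmmFun s (fun _ => diagonalForm d) v = 0 → v ⬝ᵥ α = 0 := by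
      intro v hfv
      by_cases hv : v = 0
      · rw [hv, zero_dotProduct]
      · obtain ⟨l, c, rfl⟩ := h.exists_smul_eq hv hfv
        rw [smul_dotProduct, hα, smul_zero]
    have hvec : ∀ (j : Fin n₁) (i : Fin n₂) (a b c : ZMod 3), quadricVector s j i a b c ⬝ᵥ α =
        a * α (Sum.inl j) + b * α (Sum.inr (Sum.inl i)) +
          c * α (Sum.inr (Sum.inr (Sum.inl i))) := by
      intro j i a b c
      simp [quadricVector, add_dotProduct, smul_dotProduct]
    have hy : ∀ i, α (Sum.inr (Sum.inl i)) = 0 := by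
      intro i
      have := hzero _ ((gmmFun_quadricVector d j i 0 1 0).trans (by ring))
      rw [hvec] at this
      linear_combination this
    have hz : ∀ i, α (Sum.inr (Sum.inr (Sum.inl i))) = 0 := by
      intro i
      have := hzero _ ((gmmFun_quadricVector d j i 0 0 1).trans (by ring))
      rw [hvec] at this
      linear_combination this
    funext q
    rcases q with k | k | k | k
    · have := hzero _ ((gmmFun_quadricVector d k i 1 1 (-d k)).trans (by ring))
      rw [hvec, hy, hz] at this
      simpa using this
    · exact hy k
    · exact hz k
    · have := hzero (Pi.single (Sum.inr (Sum.inr (Sum.inr k))) 1)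
        (by simp [gmmFun, diagonalForm])
      simpa using this
  · refine h.sum_dotProduct_mul (gmmFun_neg d) _ (totalDegree_gmmPolynomial_le d)
      (eval_gmmPolynomial d) ?_
    simp only [Fintype.card_sum, Fintype.card_fin]
    omega
  · intro l a b hl
    have h1 : x l = quadricVector s j i a b b := by
      rw [hl]
      simp [quadricVector, smul_add]
      abel
    have h2 := (h.1 l).2
    rw [h1, gmmFun_quadricVector, hj] at h2
    -- On the plane the form is a² + b², which is anisotropic over 𝔽₃.
    have h3 : ∀ a b : ZMod 3, 1 * a ^ 2 + b * b = 0 → a = 0 ∧ b = 0 := by decide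
    obtain ⟨rfl, rfl⟩ := h3 a b h2
    exact (h.1 l).1 (by rw [h1]; simp [quadricVector])
  · exact ⟨Pi.single (Sum.inl j) 1, Pi.single (Sum.inr (Sum.inl i)) 1, by
      simp [quadricVector], by simp [quadricVector], by simp [quadricVector],
      by simp [quadricVector]⟩

/-- The anisotropic plane is contained in the span of three points of the quadric. -/
lemma exists_quantumWeight_le_three
    (h : IsZeroTransversal (gmmFun s fun _ => diagonalForm d) x) (j : Fin n₁) (i : Fin n₂)
    (hj : d j = 1) :
    ∃ e₁ e₂ : Fin L → ZMod 3, Matrix.vecMul e₁ (Matrix.of x) = quadricVector s j i 1 0 0 ∧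
      Matrix.vecMul e₂ (Matrix.of x) = quadricVector s j i 0 1 1 ∧ quantumWeight e₁ e₂ ≤ 3 := by
  have hpt : ∀ a b c : ZMod 3, quadricVector s j i a b c ≠ 0 → a ^ 2 + b * c = 0 →
      ∃ (l : Fin L) (r : ZMod 3), quadricVector s j i a b c = r • x l := by
    intro a b c h0 h1
    exact h.exists_smul_eq h0 (by rw [gmmFun_quadricVector, hj, one_mul, h1])
  -- With P₁ = (1, 1, -1), P₂ = (0, 1, 0), P₃ = (0, 0, 1) on the quadric, v₁ = P₁ - P₂ + P₃ and v₂ =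
  -- P₂ + P₃.
  obtain ⟨l₁, r₁, h₁⟩ := hpt 1 1 (-1)
    (fun h0 => by simpa [quadricVector] using congrFun h0 (Sum.inl j)) (by ring)
  obtain ⟨l₂, r₂, h₂⟩ := hpt 0 1 0
    (fun h0 => by simpa [quadricVector] using congrFun h0 (Sum.inr (Sum.inl i))) (by ring)
  obtain ⟨l₃, r₃, h₃⟩ := hpt 0 0 1
    (fun h0 => by simpa [quadricVector] using congrFun h0 (Sum.inr (Sum.inr (Sum.inl i))))
    (by ring)
  have hsingle : ∀ (l : Fin L) (r : ZMod 3),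
      Matrix.vecMul (Pi.single l r) (Matrix.of x) = r • x l := by
    intro l r
    rw [Matrix.single_vecMul]; rfl
  refine ⟨Pi.single l₁ r₁ - Pi.single l₂ r₂ + Pi.single l₃ r₃, Pi.single l₂ r₂ + Pi.single l₃ r₃,
    ?_, ?_, ?_⟩
  · rw [Matrix.add_vecMul, Matrix.sub_vecMul, hsingle, hsingle, hsingle, ← h₁, ← h₂, ← h₃]
    simp only [quadricVector]
    module
  · rw [Matrix.add_vecMul, hsingle, hsingle, ← h₂, ← h₃]
    simp only [quadricVector]
    module
  · refine (Finset.card_le_card (t := {l₁, l₂, l₃}) fun l hl => ?_).trans Finset.card_le_three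
    simp only [Finset.mem_filter, Finset.mem_univ, true_and] at hl
    by_contra hcon
    simp only [Finset.mem_insert, Finset.mem_singleton, not_or] at hcon
    simp [Pi.single_eq_of_ne hcon.1, Pi.single_eq_of_ne hcon.2.1,
      Pi.single_eq_of_ne hcon.2.2] at hl

end QuadricPoints

/-! ### Numerical conditions and assembly of the code -/

section Parameters

/-- The numerical inequality that excludes distance five. -/
lemma hamming_inequality {L M : ℝ} (hM : 0 ≤ M)
    (hLM : (13 ≤ L ∧ M ≤ 2 * L + 1) ∨ (31 ≤ L ∧ 7 * M ≤ 9 * (2 * L + 1))) {w : ℝ}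
    (hw4 : w ≤ 4) :
    M ^ 2 * (((8 * L) ^ 2 - 64 * L) / 2) <
      (((8 * L - 9 * w) ^ 2 - (64 * (L - w) + w)) / 2) ^ 2 := by
  have hL : 13 ≤ L := by rcases hLM with h | h <;> linarith [h.1]
  -- The right-hand side decreases in w on this range, and the bound is its value at w = 4.
  have h1 : 32 * L ^ 2 - 320 * L + 774 ≤
      ((8 * L - 9 * w) ^ 2 - (64 * (L - w) + w)) / 2 := by
    nlinarith [mul_nonneg (sub_nonneg.2 hw4) (sub_nonneg.2 hL)]
  have h2 : 0 < 32 * L ^ 2 - 320 * L + 774 := by nlinarith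
  refine lt_of_lt_of_le ?_ (pow_le_pow_left₀ h2.le h1 2)
  have h3 : 0 ≤ ((8 * L) ^ 2 - 64 * L) / 2 := by nlinarith
  rcases hLM with ⟨-, h4⟩ | ⟨h5, h4⟩
  · refine lt_of_le_of_lt (mul_le_mul_of_nonneg_right (pow_le_pow_left₀ hM h4 2) h3) ?_
    -- After this shift the difference of the two sides is a polynomial in t with positive
    -- coefficients. The same holds for the shift by 31 below.
    obtain ⟨t, rfl⟩ : ∃ t, L = 13 + t := ⟨L - 13, by ring⟩
    have ht : 0 ≤ t := by linarith
    have : 0 ≤ t ^ 2 := by positivity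
    have : 0 ≤ t ^ 3 := by positivity
    have : 0 ≤ t ^ 4 := by positivity
    nlinarith
  · have h6 : M ≤ 9 / 7 * (2 * L + 1) := by linarith
    refine lt_of_le_of_lt (mul_le_mul_of_nonneg_right (pow_le_pow_left₀ hM h6 2) h3) ?_
    obtain ⟨t, rfl⟩ : ∃ t, L = 31 + t := ⟨L - 31, by ring⟩
    have ht : 0 ≤ t := by linarith
    have : 0 ≤ t ^ 2 := by positivity
    have : 0 ≤ t ^ 3 := by positivity
    have : 0 ≤ t ^ 4 := by positivity
    nlinarith

lemma not_isQuantumCode_five_ternary {L n k : ℕ} (hn : 1 ≤ n) (hk : k + 2 * n = L + 2)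
    (hL : (13 ≤ L ∧ 3 ^ (n - 1) ≤ 2 * L + 1) ∨ (31 ≤ L ∧ 7 * 3 ^ (n - 1) ≤ 9 * (2 * L + 1)))
    (Q : Submodule ℂ (QState 3 L)) : ¬ IsQuantumCode k 5 Q := by
  -- Here L - k = 2n - 2, so the factor 3^m is the square of M = 3^(n-1).
  refine not_isQuantumCode_five (m := (n - 1) * 2) (by omega) (fun w hw _ => ?_) Q
  have hLM : (13 ≤ (L : ℝ) ∧ (3 : ℝ) ^ (n - 1) ≤ 2 * L + 1) ∨
      (31 ≤ (L : ℝ) ∧ 7 * (3 : ℝ) ^ (n - 1) ≤ 9 * (2 * L + 1)) := by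
    exact_mod_cast hL
  have hw4 : (w : ℝ) ≤ 4 := by exact_mod_cast Nat.le_of_lt_succ hw
  have := hamming_inequality (by positivity) hLM hw4
  rw [pow_mul]
  norm_num at this ⊢
  exact this

/-- This growth bound keeps k = L - 2n + 2 positive in both cases. -/
lemma six_mul_le_three_pow {n : ℕ} (hn : 4 ≤ n) : 6 * n ≤ 3 ^ (n - 1) := by
  obtain ⟨m, rfl⟩ := Nat.exists_eq_add_of_le hn
  rw [show 4 + m - 1 = m + 3 by omega]
  induction m with
  | zero => norm_num
  | succ m ih =>
    have := ih (by omega)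
    rw [show m + 1 + 3 = (m + 3) + 1 by ring, pow_succ]
    omega

/-- The quantum code of a quadric of rank at least three in dimension at least four. -/
theorem yieldsTernaryQuantumCode_quadric {n₁ n₂ s L k n : ℕ} {d : Fin n₁ → ZMod 3}
    (j : Fin n₁) (hj : d j = 1) (hn₂ : 1 ≤ n₂) (hn : n₁ + 2 * n₂ + s = n)
    (hn4 : 4 ≤ n)
    (hcard : 2 * L + 1 =
      (Finset.univ.filter fun v => gmmFun (n₂ := n₂) s (fun _ => diagonalForm d) v = 0).card)
    (hk1 : 1 ≤ k) (hk : k + 2 * n = L + 2)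
    (hL : (13 ≤ L ∧ 3 ^ (n - 1) ≤ 2 * L + 1) ∨ (31 ≤ L ∧ 7 * 3 ^ (n - 1) ≤ 9 * (2 * L + 1))) :
    YieldsTernaryQuantumCode (gmmFun (n₂ := n₂) s fun _ => diagonalForm d) L k := by
  obtain ⟨L', x, hx⟩ := exists_isZeroTransversal (gmmFun_neg (n₂ := n₂) (s := s) d)
  have hLL : L' = L := by
    have := hx.two_mul_add_one (gmmFun_neg d) (gmmFun_zero d)
    omega
  subst hLL
  have hconf := isSteaneConfiguration_quadric hx (by omega) j ⟨0, hn₂⟩ hj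
  obtain ⟨e₁, e₂, he₁, he₂, hw⟩ := exists_quantumWeight_le_three hx j ⟨0, hn₂⟩ hj
  obtain ⟨C, hC, hsteane⟩ := hconf.isSteaneEnlargement_fixedCode he₁ he₂
  have hcode := hconf.isQuantumCode_fixedCode hk1 (by
    simp only [Fintype.card_sum, Fintype.card_fin]; omega)
  have hfive := not_isQuantumCode_five_ternary (by omega) hk hL
  refine ⟨x, C, _, hx, hC, hsteane, hcode, hconf.qDistLE_fixedCode he₁ he₂ hw,
    hconf.isPure_fixedCode, ?_⟩
  -- With distance 5 excluded, any code of distance 4 is optimal, so either alternative gives the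
  -- claim.
  by_cases hfour : ∃ Q' : Submodule ℂ (QState 3 L'), IsQuantumCode k 4 Q'
  · obtain ⟨Q', hQ'⟩ := hfour
    exact Or.inr ⟨hcode, Q', hQ', fun ⟨Q'', hQ''⟩ => hfive Q'' hQ''⟩
  · exact Or.inl ⟨hcode, hfour⟩

end Parameters

/-! ### Choice of the forms in the even and odd cases -/

section Existence

lemma sqrt_three_mul_I_mul_self :
    ((Real.sqrt 3 : ℂ) * Complex.I) * ((Real.sqrt 3 : ℂ) * Complex.I) = -3 := by
  have h : (Real.sqrt 3 : ℂ) * (Real.sqrt 3 : ℂ) = 3 := by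
    rw [← Complex.ofReal_mul, Real.mul_self_sqrt (by norm_num)]
    norm_num
  linear_combination (Complex.I * Complex.I) * h + 3 * Complex.I_mul_I

/-- The two Gauss sums are ±i√3. The binary form x₁² - x₂² is hyperbolic and gives sign +1, while
x₁² + x₂² is anisotropic and gives -1. -/
lemma exists_ternaryGaussSum_mul {ε : ℤ} (hε : ε = 1 ∨ ε = -1) :
    ∃ c : ZMod 3, c ≠ 0 ∧ ternaryGaussSum 1 * ternaryGaussSum c = (ε : ℂ) * 3 := by
  have h2 : (-1 : ZMod 3) ≠ 1 := by decide
  rcases hε with rfl | rfl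
  · refine ⟨-1, by decide, ?_⟩
    rw [ternaryGaussSum, ternaryGaussSum, if_pos rfl, if_neg h2]
    push_cast
    linear_combination -sqrt_three_mul_I_mul_self
  · refine ⟨1, one_ne_zero, ?_⟩
    rw [ternaryGaussSum, if_pos rfl]
    push_cast
    linear_combination sqrt_three_mul_I_mul_self

/-- Two x-variables with coefficients 1 and c: the sign of the Gauss product is the type. The
coefficient 1 supplies the anisotropic plane for either type. -/
theorem exists_even_code {n₂ s : ℕ} {ε : ℤ} (hε : ε = 1 ∨ ε = -1) (hn₂ : 1 ≤ n₂)
    (hs : 2 ≤ n₂ + s) :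
    ∃ (L k : ℕ) (g : (Fin n₂ → ZMod 3) → (Fin 2 → ZMod 3) → ZMod 3),
      2 * (L : ℤ) = 3 ^ (1 + 2 * n₂ + s) + 2 * ε * 3 ^ (n₂ + s) - 1 ∧
      k + 2 * (2 + 2 * n₂ + s) = L + 2 ∧ IsAdmissibleFamily g ∧
      IsPlateaued (gmmFun s g) s ∧ HasType (gmmFun s g) s ε ∧
      YieldsTernaryQuantumCode (gmmFun s g) L k := by
  obtain ⟨c, hc, hmul⟩ := exists_ternaryGaussSum_mul hε
  let d : Fin 2 → ZMod 3 := ![1, c]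
  have hd : ∀ i, d i ≠ 0 := by
    intro i
    fin_cases i
    · exact one_ne_zero
    · exact hc
  have hprod : ∏ i, ternaryGaussSum (d i) = (ε : ℂ) * 3 := by
    rw [Fin.prod_univ_two]; exact hmul
  have hsqrt : (Real.sqrt 3 : ℂ) ^ 2 = 3 := by
    rw [← Complex.ofReal_pow, Real.sq_sqrt (by norm_num)]
    norm_num
  have hW := walsh_zero_gmmFun_diagonalForm n₂ s hd
  rw [hprod] at hW
  obtain ⟨L, x, hx⟩ := exists_isZeroTransversal (gmmFun_neg (n₂ := n₂) (s := s) d)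
  have hN := hx.two_mul_add_one (gmmFun_neg d) (gmmFun_zero d)
  have h3N := three_mul_card_zeros (gmmFun (n₂ := n₂) s fun _ => diagonalForm d)
  rw [← hN, hW] at h3N
  simp only [Fintype.card_sum, Fintype.card_fin, map_mul, map_pow, map_ofNat,
    map_intCast] at h3N
  have hL : 2 * (L : ℤ) = 3 ^ (1 + 2 * n₂ + s) + 2 * ε * 3 ^ (n₂ + s) - 1 := by
    have h4 : (3 : ℤ) * (2 * L + 1) =
        3 ^ (2 + (n₂ + (n₂ + s))) + ε * 3 * 3 ^ (n₂ + s) + ε * 3 * 3 ^ (n₂ + s) := by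
      exact_mod_cast h3N
    have h5 : (3 : ℤ) ^ (2 + (n₂ + (n₂ + s))) = 3 * 3 ^ (1 + 2 * n₂ + s) := by
      rw [← pow_succ']; congr 1; ring
    rw [h5] at h4
    linarith
  -- Since n₂ ≥ 1, the correction 2 · 3^(n₂+s) is at most 2/9 of 3^(n-1), whence 2L + 1 ≥ (7/9)
  -- 3^(n-1). With 3^(n-1) ≥ 81 this gives L ≥ 31.
  have hM9 : 9 * (3 : ℤ) ^ (n₂ + s) ≤ 3 ^ (1 + 2 * n₂ + s) := by
    rw [show (9 : ℤ) = 3 ^ 2 by norm_num, ← pow_add]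
    exact pow_le_pow_right₀ (by norm_num) (by omega)
  have hM0 : (0 : ℤ) < 3 ^ (n₂ + s) := by positivity
  have hM81 : (81 : ℤ) ≤ 3 ^ (1 + 2 * n₂ + s) := by
    rw [show (81 : ℤ) = 3 ^ 4 by norm_num]
    exact pow_le_pow_right₀ (by norm_num) (by omega)
  have h7 : 7 * (3 : ℤ) ^ (1 + 2 * n₂ + s) ≤ 9 * (2 * L + 1) := by
    rcases hε with rfl | rfl <;> linarith
  have h6n : (6 : ℤ) * (2 + 2 * n₂ + s) ≤ 3 ^ (1 + 2 * n₂ + s) := by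
    have := six_mul_le_three_pow (n := 2 + 2 * n₂ + s) (by omega)
    rw [show 2 + 2 * n₂ + s - 1 = 1 + 2 * n₂ + s by omega] at this
    exact_mod_cast this
  have hkL : 2 * (2 + 2 * n₂ + s) < L + 2 := by omega
  refine ⟨L, L + 2 - 2 * (2 + 2 * n₂ + s), fun _ => diagonalForm d, hL, by omega, ?_,
    isPlateaued_gmmFun_diagonalForm n₂ s hd, ⟨hε, 0, ?_⟩, ?_⟩
  · refine isAdmissibleFamily_diagonalForm hd (ε : ℂ) ?_ (by rw [hprod, hsqrt])
    rcases hε with rfl | rfl <;> simp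
  · rw [hW, AddChar.map_zero_eq_one, mul_one]
    simp only [Fintype.card_sum, Fintype.card_fin, Nat.cast_ofNat]
    have he : 2 + (n₂ + (n₂ + s)) + s = 2 * (1 + (n₂ + s)) := by ring
    have hsign : signUnit 3 (2 * (1 + (n₂ + s))) = 1 := by
      rw [signUnit, if_pos]
      rw [pow_mul, Nat.pow_mod]
      norm_num
    rw [he, hsign, sqrt_three_pow, pow_mul, Real.sq_sqrt (by norm_num), pow_add]
    push_cast
    ring
  · refine yieldsTernaryQuantumCode_quadric (n := 2 + 2 * n₂ + s) 0 rfl hn₂ rfl (by omega) hN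
      (by omega) (by omega) (Or.inr ⟨by omega, ?_⟩)
    rw [show 2 + 2 * n₂ + s - 1 = 1 + 2 * n₂ + s by omega]
    exact_mod_cast h7

/-- With the single form x² the Walsh value at 0 is purely imaginary, so it cancels against its
conjugate and f has exactly 3^(n-1) zeros. -/
theorem exists_odd_code {n₂ s : ℕ} (hn₂ : 1 ≤ n₂) (hs : 2 ≤ n₂ + s) :
    ∃ (L k : ℕ) (g : (Fin n₂ → ZMod 3) → (Fin 1 → ZMod 3) → ZMod 3),
      2 * (L : ℤ) = 3 ^ (2 * n₂ + s) - 1 ∧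
      k + 2 * (1 + 2 * n₂ + s) = L + 2 ∧ IsAdmissibleFamily g ∧
      IsPlateaued (gmmFun s g) s ∧ YieldsTernaryQuantumCode (gmmFun s g) L k := by
  let d : Fin 1 → ZMod 3 := fun _ => 1
  have hd : ∀ i, d i ≠ 0 := fun _ => one_ne_zero
  have hprod : ∏ i, ternaryGaussSum (d i) = (Real.sqrt 3 : ℂ) * Complex.I := by
    rw [Fin.prod_univ_one, ternaryGaussSum, if_pos rfl, one_mul]
  have hW := walsh_zero_gmmFun_diagonalForm n₂ s hd
  rw [hprod] at hW
  obtain ⟨L, x, hx⟩ := exists_isZeroTransversal (gmmFun_neg (n₂ := n₂) (s := s) d)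
  have hN := hx.two_mul_add_one (gmmFun_neg d) (gmmFun_zero d)
  have h3N := three_mul_card_zeros (gmmFun (n₂ := n₂) s fun _ => diagonalForm d)
  rw [← hN, hW] at h3N
  simp only [Fintype.card_sum, Fintype.card_fin, map_mul, map_pow, map_ofNat, Complex.conj_I,
    Complex.conj_ofReal] at h3N
  have hL : 2 * (L : ℤ) = 3 ^ (2 * n₂ + s) - 1 := by
    have h4 : (3 : ℤ) * (2 * L + 1) = 3 ^ (1 + (n₂ + (n₂ + s))) := by
      have : (3 : ℂ) * (2 * L + 1) = 3 ^ (1 + (n₂ + (n₂ + s))) := by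
        push_cast at h3N
        linear_combination h3N
      exact_mod_cast this
    have h5 : (3 : ℤ) ^ (1 + (n₂ + (n₂ + s))) = 3 * 3 ^ (2 * n₂ + s) := by
      rw [← pow_succ']; congr 1; ring
    rw [h5] at h4
    linarith
  have hM27 : (27 : ℤ) ≤ 3 ^ (2 * n₂ + s) := by
    rw [show (27 : ℤ) = 3 ^ 3 by norm_num]
    exact pow_le_pow_right₀ (by norm_num) (by omega)
  have h6n : (6 : ℤ) * (1 + 2 * n₂ + s) ≤ 3 ^ (2 * n₂ + s) := by
    have := six_mul_le_three_pow (n := 1 + 2 * n₂ + s) (by omega)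
    rw [show 1 + 2 * n₂ + s - 1 = 2 * n₂ + s by omega] at this
    exact_mod_cast this
  have hkL : 2 * (1 + 2 * n₂ + s) < L + 2 := by omega
  refine ⟨L, L + 2 - 2 * (1 + 2 * n₂ + s), fun _ => diagonalForm d, hL, by omega, ?_,
    isPlateaued_gmmFun_diagonalForm n₂ s hd, ?_⟩
  · refine isAdmissibleFamily_diagonalForm hd Complex.I (by simp) ?_
    rw [hprod, pow_one, mul_comm]
  · refine yieldsTernaryQuantumCode_quadric (n := 1 + 2 * n₂ + s) 0 rfl hn₂ rfl (by omega) hN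
      (by omega) (by omega) (Or.inl ⟨by omega, ?_⟩)
    rw [show 1 + 2 * n₂ + s - 1 = 2 * n₂ + s by omega]
    have h8 : (3 : ℤ) ^ (2 * n₂ + s) ≤ 2 * L + 1 := by omega
    exact_mod_cast h8

end Existence

theorem theorem8 :
    (∀ (n s : ℕ) (ε : ℤ), Even (n + s) → s + 4 ≤ n → 6 ≤ n + s → (ε = 1 ∨ ε = -1) →
      ∃ (L k n₁ n₂ : ℕ) (g : (Fin n₂ → ZMod 3) → (Fin n₁ → ZMod 3) → ZMod 3),
        2 * (L : ℤ) = 3 ^ (n - 1) + 2 * ε * 3 ^ ((n + s) / 2 - 1) - 1 ∧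
        (k : ℤ) = (L : ℤ) - 2 * (n : ℤ) + 2 ∧
        1 ≤ n₁ ∧ 1 ≤ n₂ ∧ n₁ + 2 * n₂ + s = n ∧ IsAdmissibleFamily g ∧
        IsPlateaued (gmmFun s g) s ∧ HasType (gmmFun s g) s ε ∧
        YieldsTernaryQuantumCode (gmmFun s g) L k) ∧
    (∀ n s : ℕ, Odd (n + s) → s + 3 ≤ n → 5 ≤ n + s →
      ∃ (L k n₁ n₂ : ℕ) (g : (Fin n₂ → ZMod 3) → (Fin n₁ → ZMod 3) → ZMod 3),
        2 * (L : ℤ) = 3 ^ (n - 1) - 1 ∧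
        (k : ℤ) = (L : ℤ) - 2 * (n : ℤ) + 2 ∧
        1 ≤ n₁ ∧ 1 ≤ n₂ ∧ n₁ + 2 * n₂ + s = n ∧ IsAdmissibleFamily g ∧
        IsPlateaued (gmmFun s g) s ∧
        YieldsTernaryQuantumCode (gmmFun s g) L k) := by
  constructor
  · intro n s ε heven hsn hns hε
    obtain ⟨r, hr⟩ := heven
    obtain ⟨n₂, rfl⟩ : ∃ n₂, n = 2 + 2 * n₂ + s := ⟨(n - s - 2) / 2, by omega⟩
    obtain ⟨L, k, g, hL, hk, hg, hpl, htype, hcode⟩ :=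
      exists_even_code (n₂ := n₂) (s := s) hε (by omega) (by omega)
    refine ⟨L, k, 2, n₂, g, ?_, by omega, by omega, by omega, rfl, hg, hpl, htype, hcode⟩
    rw [hL, show 2 + 2 * n₂ + s - 1 = 1 + 2 * n₂ + s by omega,
      show (2 + 2 * n₂ + s + s) / 2 - 1 = n₂ + s by omega]
  · intro n s hodd hsn hns
    obtain ⟨r, hr⟩ := hodd
    obtain ⟨n₂, rfl⟩ : ∃ n₂, n = 1 + 2 * n₂ + s := ⟨(n - s - 1) / 2, by omega⟩
    obtain ⟨L, k, g, hL, hk, hg, hpl, hcode⟩ :=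
      exists_odd_code (n₂ := n₂) (s := s) (by omega) (by omega)
    refine ⟨L, k, 1, n₂, g, ?_, by omega, by omega, by omega, rfl, hg, hpl, hcode⟩
    rw [hL, show 1 + 2 * n₂ + s - 1 = 2 * n₂ + s by omega]
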